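/- Let $X=(X(t))_{t\ge 0}$ be an irreducible continuous-time Markov chain on the finite state space $\mathcal S=\{1,\dots,S\}$, with right-continuous paths, arbitrary initial distribution, generator $Q$, transition matrices $P(t)=e^{Qt}$ and stationary distribution $\pi=(\pi_1,\dots,\pi_S)$. Let $(Y_k)_{k\ge 0}$ (forward delays, i.i.d. copies of $Y$) and $(D_k)_{k\ge 0}$ (backward delays, i.i.d. copies of $D$) be non-negative random variables with finite expectations; all of them are mutually independent and independent of $X$. Let $Z=Y+D$, where $Y$ and $D$ are independent, let $F^Z$ and $F^D$ be the distribution functions of $Z$ and $D$, and assume $\mathbb E[Z]>0$. A monitor tracks $X$ by queries under the zero-wait policy: query $0$ is sent at time $0$; query $k$ reaches the source $Y_k$ time units after it was sent, the source immediately replies with its current state, and the reply reaches the monitor a further $D_k$ time units later, at which moment query $k+1$ is sent. Between receipts of replies the monitor's estimate is $\hat X(t)=e(i,a)$, where $i$ is the most recently received state, $a$ is the time elapsed since the source was in that state when it generated the reply, and $e:\mathcal S\times[0,\infty)\to\mathcal S$ is an arbitrary estimator, measurable in $a$; before the first reply the estimate is an arbitrary fixed state. Then the mean binary freshness $$\mathbb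 E[\Delta]=\limsup_{T\to\infty}\frac1T\,\mathbb E\left[\int_0^T \mathbf 1\{X(t)=\hat X(t)\}\,dt\right]$$ satisfies $$\mathbb E[\Delta]=\frac{\sum_{i=1}^S \pi_i\,\mathbb E[g(i)]}{\mathbb E[Z]},\qquad \mathbb E[g(i)]=\int_{[0,\infty)}\int_0^\infty P_{i,\,e(i,t+d)}(t+d)\,\bigl(1-F^Z(t)\bigr)\,dt\,dF^D(d).$$ -/

import Mathlib

open MeasureTheory ProbabilityTheory Filter Topology
open scoped NNReal

noncomputable section

namespace QueryMBF

/-- `Q` is the generator matrix of an irreducible continuous-time Markov chain on `Fin N`: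
off-diagonal rates are nonnegative, rows sum to zero, and every state can be reached from every
state along transitions of positive rate. (The diagonal entries are then nonpositive.) -/
structure IsIrreducibleGenerator {N : ℕ} (Q : Matrix (Fin N) (Fin N) ℝ) : Prop where
  rate_nonneg : ∀ i j, i ≠ j → 0 ≤ Q i j
  row_sum : ∀ i, ∑ j, Q i j = 0
  irreducible : ∀ i j, Relation.ReflTransGen (fun a b => 0 < Q a b) i j

/-- The transition matrix `P(t) = exp(t Q)`. -/
def transMat {N : ℕ} (Q : Matrix (Fin N) (Fin N) ℝ) (t : ℝ) : Matrix (Fin N) (Fin N) ℝ :=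
  NormedSpace.exp (t • Q)

/-- `X` is a continuous-time Markov chain with generator `Q` on the probability space `(Ω, μ)`,
with an arbitrary initial distribution and right-continuous paths (for the discrete topology). -/
structure IsCTMC {Ω : Type*} [MeasurableSpace Ω] (μ : Measure Ω) {N : ℕ}
    (Q : Matrix (Fin N) (Fin N) ℝ) (X : ℝ≥0 → Ω → Fin N) : Prop where
  measurable : ∀ t, Measurable (X t)
  rightCts : ∀ ω t, ∀ᶠ s in 𝓝[≥] t, X s ω = X t ω
  fdd : ∀ (n : ℕ) (t : Fin (n + 1) → ℝ≥0), Monotone t → ∀ x : Fin (n + 1) → Fin N,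
    μ.real {ω | ∀ k, X (t k) ω = x k} =
      μ.real {ω | X (t 0) ω = x 0} *
        ∏ k : Fin n, transMat Q ((t k.succ : ℝ) - (t k.castSucc : ℝ)) (x k.castSucc) (x k.succ)

/-- `p` is a stationary distribution of the chain with generator `Q`. -/
structure IsStationaryDist {N : ℕ} (Q : Matrix (Fin N) (Fin N) ℝ) (p : Fin N → ℝ) : Prop where
  nonneg : ∀ i, 0 ≤ p i
  sum_eq_one : ∑ i, p i = 1
  invariant : ∀ t : ℝ, 0 ≤ t → ∀ j, ∑ i, p i * transMat Q t i j = p j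

/-- The forward delays `Y 0, Y 1, …` have law `νY`, the backward delays `D 0, D 1, …` have law
`νD`, all the delays are mutually independent, and they are independent of the path of `X`. -/
structure IsDelaySystem {Ω : Type*} [MeasurableSpace Ω] (μ : Measure Ω) {N : ℕ}
    (X : ℝ≥0 → Ω → Fin N) (νY νD : Measure ℝ≥0) (Y D : ℕ → Ω → ℝ≥0) : Prop where
  measurable_forward : ∀ k, Measurable (Y k)
  measurable_backward : ∀ k, Measurable (D k)
  law_forward : ∀ k, μ.map (Y k) = νY
  law_backward : ∀ k, μ.map (D k) = νD
  indep_delays : iIndepFun (Sum.elim Y D) μ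
  indep_source : IndepFun (fun ω t => X t ω) (fun ω q => Sum.elim Y D q ω) μ

section Monitor

variable {Ω : Type*} {N : ℕ}

/-- The time at which query `k` is sent under the waiting policy `W`. Query `0` is sent at time
`0`. Query `k` reaches the source `Y k` later, the reply (the state at that moment) reaches the
monitor a further `D k` later, and the next query is sent after waiting `W i d`, where `i` is the
state just received and `d = D k` its age. -/
def sendTime (W : Fin N → ℝ≥0 → ℝ≥0) (X : ℝ≥0 → Ω → Fin N) (Y D : ℕ → Ω → ℝ≥0) :
    ℕ → Ω → ℝ≥0
  | 0, _ => 0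
  | k + 1, ω =>
      sendTime W X Y D k ω + Y k ω + D k ω
        + W (X (sendTime W X Y D k ω + Y k ω) ω) (D k ω)

/-- The time at which query `k` reaches the source, which then replies with its state. -/
def sampleTime (W : Fin N → ℝ≥0 → ℝ≥0) (X : ℝ≥0 → Ω → Fin N) (Y D : ℕ → Ω → ℝ≥0)
    (k : ℕ) (ω : Ω) : ℝ≥0 :=
  sendTime W X Y D k ω + Y k ω

/-- The time at which the monitor receives the reply to query `k`. -/
def receiptTime (W : Fin N → ℝ≥0 → ℝ≥0) (X : ℝ≥0 → Ω → Fin N) (Y D : ℕ → Ω → ℝ≥0)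
    (k : ℕ) (ω : Ω) : ℝ≥0 :=
  sampleTime W X Y D k ω + D k ω

/-- The index of the last reply received up to time `t` (relevant once a reply was received). -/
def lastReply (W : Fin N → ℝ≥0 → ℝ≥0) (X : ℝ≥0 → Ω → Fin N) (Y D : ℕ → Ω → ℝ≥0)
    (t : ℝ≥0) (ω : Ω) : ℕ :=
  sSup {k | receiptTime W X Y D k ω ≤ t}

/-- The estimate held by the monitor. An estimator is a function `e` of the most recently received
state and the current age of that information; `e i a = i` is the martingale estimator, and
`e i a ∈ argmax_j P_{i,j}(a)` is the MAP estimator. Before the first reply the estimate is `x₀`. -/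
def estimate (e : Fin N → ℝ≥0 → Fin N) (x₀ : Fin N) (W : Fin N → ℝ≥0 → ℝ≥0)
    (X : ℝ≥0 → Ω → Fin N) (Y D : ℕ → Ω → ℝ≥0) (t : ℝ≥0) (ω : Ω) : Fin N :=
  if t < receiptTime W X Y D 0 ω then x₀
  else
    e (X (sampleTime W X Y D (lastReply W X Y D t ω) ω) ω)
      (t - sampleTime W X Y D (lastReply W X Y D t ω) ω)

/-- Mean binary freshness
`limsup_{T → ∞} (1 / T) E[∫_0^T 1{X(t) = Xhat(t)} dt]`. -/
def meanBinaryFreshness [MeasurableSpace Ω] (μ : Measure Ω) (X Xhat : ℝ≥0 → Ω → Fin N) : ℝ :=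
  limsup (fun T : ℝ => (1 / T) *
    ∫ ω, (∫ t in (0 : ℝ)..T, if X t.toNNReal ω = Xhat t.toNNReal ω then (1 : ℝ) else 0) ∂μ) atTop

end Monitor

/-- The law of the combined delay `Z = Y + D`, with `Y` and `D` independent. -/
def totalDelayLaw (νY νD : Measure ℝ≥0) : Measure ℝ :=
  (νY.prod νD).map (fun q => (q.1 : ℝ) + (q.2 : ℝ))

/-- `E[Z]`. -/
def meanTotalDelay (νY νD : Measure ℝ≥0) : ℝ := ∫ z, z ∂(totalDelayLaw νY νD)

/-- `E[g^W(i)] = ∫_D ∫_0^∞ P_{i, e(i, t+d)}(t+d) (1 - F^Z(t - W(i,d))) dt dF^D(d)`. -/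
def meanFreshTime {N : ℕ} (Q : Matrix (Fin N) (Fin N) ℝ) (e : Fin N → ℝ≥0 → Fin N)
    (νY νD : Measure ℝ≥0) (W : Fin N → ℝ≥0 → ℝ≥0) (i : Fin N) : ℝ :=
  ∫ d, (∫ t in Set.Ioi (0 : ℝ),
    transMat Q (t + (d : ℝ)) i (e i (t.toNNReal + d)) *
      (1 - cdf (totalDelayLaw νY νD) (t - (W i d : ℝ)))) ∂νD

/-- The zero-wait policy `W(i, d) = 0`. -/
def zeroWait (N : ℕ) : Fin N → ℝ≥0 → ℝ≥0 := fun _ _ => 0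

end QueryMBF

end

open QueryMBF

/-! Under zero waiting the whole timetable is a function of the delays alone, and the delays are
independent of the chain. So freeze the delays and average over the path first
(`IsDelaySystem.integral_fresh`). All sampling times are then deterministic, and only the two-time
laws of the chain are needed; the strong Markov property never enters.

With delays frozen, let `h a = ∑ i, p i * freshKernel Q e i a` be the freshness probability at age
`a` in equilibrium. While reply `k` is in use, the probability of being fresh differs from `h` at
the current age by at most the `ℓ¹` distance between the law of the chain at the sampling time and
`p` (`IsCTMC.abs_freshProb_sub_le`). Sampling times tend to infinity, and this distance tends to
zero by a Doeblin contraction (`tendsto_vecMul_transMat`), so the error is negligible on long-run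
average.

What remains is a renewal-reward computation. The cycle that uses reply `k` has length `Y (k + 1) +
D (k + 1)` and starts at age `D k`. Its rewards are identically distributed but not independent,
since neighbouring cycles share a backward delay; the strong law is applied to even and odd cycles
separately (`IsDelaySystem.strong_law_cycle`). A sandwich between receipt times gives the limit for
almost every realisation of the delays (`Delays.tendsto_average`), dominated convergence passes to
the expectation, and the layer-cake formula turns the mean reward into the stated integral. -/

noncomputable section

namespace QueryMBF

/-! ### The transition semigroup: positivity and convergence to equilibrium. -/

section TransMat

variable {N : ℕ} {Q : Matrix (Fin N) (Fin N) ℝ}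

theorem hasSum_matrix_exp (A : Matrix (Fin N) (Fin N) ℝ) :
    HasSum (fun n : ℕ => ((n.factorial : ℝ)⁻¹) • A ^ n) (NormedSpace.exp A) := by
  let _ : NormedRing (Matrix (Fin N) (Fin N) ℝ) := Matrix.linftyOpNormedRing
  let _ : NormedAlgebra ℝ (Matrix (Fin N) (Fin N) ℝ) := Matrix.linftyOpNormedAlgebra
  exact NormedSpace.exp_series_hasSum_exp' (𝕂 := ℝ) A

theorem continuous_transMat (Q : Matrix (Fin N) (Fin N) ℝ) : Continuous (transMat Q) := by
  let _ : NormedRing (Matrix (Fin N) (Fin N) ℝ) := Matrix.linftyOpNormedRing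
  let _ : NormedAlgebra ℝ (Matrix (Fin N) (Fin N) ℝ) := Matrix.linftyOpNormedAlgebra
  let _ : NormedAlgebra ℚ (Matrix (Fin N) (Fin N) ℝ) := NormedAlgebra.restrictScalars ℚ ℝ _
  have h : Continuous (NormedSpace.exp : Matrix (Fin N) (Fin N) ℝ → Matrix (Fin N) (Fin N) ℝ) :=
    NormedSpace.exp_continuous
  exact h.comp (continuous_id.smul continuous_const)

theorem continuous_transMat_apply (Q : Matrix (Fin N) (Fin N) ℝ) (i j : Fin N) :
    Continuous fun t => transMat Q t i j :=
  (continuous_apply_apply i j).comp (continuous_transMat Q)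

theorem transMat_add (Q : Matrix (Fin N) (Fin N) ℝ) (s t : ℝ) :
    transMat Q (s + t) = transMat Q s * transMat Q t := by
  rw [transMat, add_smul]
  exact Matrix.exp_add_of_commute _ _ (((Commute.refl Q).smul_left s).smul_right t)

theorem transMat_natCast (Q : Matrix (Fin N) (Fin N) ℝ) (n : ℕ) :
    transMat Q n = transMat Q 1 ^ n := by
  rw [transMat, transMat, Nat.cast_smul_eq_nsmul, Matrix.exp_nsmul, one_smul]

/-- The generator annihilates the constant vector, so only the zeroth term of the exponential series
contributes to a row sum. -/
theorem sum_transMat_apply (hQ : IsIrreducibleGenerator Q) (t : ℝ) (i : Fin N) :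
    ∑ j, transMat Q t i j = 1 := by
  have hz : (t • Q).mulVec 1 = 0 := by
    ext i
    simp [Matrix.mulVec, dotProduct, ← Finset.mul_sum, hQ.row_sum]
  have hpow : ∀ n : ℕ, n ≠ 0 → ∑ j, ((t • Q) ^ n) i j = 0 := by
    intro n hn
    obtain ⟨k, rfl⟩ := Nat.exists_eq_succ_of_ne_zero hn
    have := congrFun (show ((t • Q) ^ (k + 1)).mulVec 1 = 0 by
      rw [pow_succ, ← Matrix.mulVec_mulVec, hz, Matrix.mulVec_zero]) i
    simpa [Matrix.mulVec, dotProduct] using this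
  have h1 : HasSum (fun n : ℕ => ∑ j, (((n.factorial : ℝ)⁻¹) • (t • Q) ^ n) i j)
      (∑ j, transMat Q t i j) :=
    hasSum_sum fun j _ => Pi.hasSum.1 (Pi.hasSum.1 (hasSum_matrix_exp (t • Q)) i) j
  have h2 : HasSum (fun n : ℕ => ∑ j, (((n.factorial : ℝ)⁻¹) • (t • Q) ^ n) i j)
      (∑ j, (((Nat.factorial 0 : ℝ)⁻¹) • (t • Q) ^ 0) i j) := by
    refine hasSum_single 0 fun n hn => ?_
    simp only [Matrix.smul_apply, smul_eq_mul, ← Finset.mul_sum, hpow n hn, mul_zero]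
  rw [h1.unique h2]
  simp [Matrix.one_apply]

/-- A shift making all the entries of a generator nonnegative. -/
def shift (Q : Matrix (Fin N) (Fin N) ℝ) : ℝ := ∑ i, |Q i i|

/-- The generator, shifted along the diagonal to be entrywise nonnegative. -/
def shifted (Q : Matrix (Fin N) (Fin N) ℝ) : Matrix (Fin N) (Fin N) ℝ :=
  Q + Matrix.diagonal fun _ => shift Q

theorem shift_nonneg (hQ : IsIrreducibleGenerator Q) (i j : Fin N) :
    0 ≤ shifted Q i j := by
  by_cases h : i = j
  · subst h
    have h1 : |Q i i| ≤ shift Q :=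
      Finset.single_le_sum (f := fun i => |Q i i|) (fun _ _ => abs_nonneg _) (Finset.mem_univ i)
    have h2 := neg_abs_le (Q i i)
    simp only [shifted, Matrix.add_apply, Matrix.diagonal_apply_eq]
    linarith
  · simpa [shifted, Matrix.add_apply, Matrix.diagonal_apply_ne _ h] using hQ.rate_nonneg i j h

theorem pow_entry_nonneg {A : Matrix (Fin N) (Fin N) ℝ} (hA : ∀ i j, 0 ≤ A i j) (n : ℕ) :
    ∀ i j, 0 ≤ (A ^ n) i j := by
  induction n with
  | zero =>
    intro i j
    rw [pow_zero, Matrix.one_apply]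
    split_ifs <;> norm_num
  | succ n ih =>
    intro i j
    rw [pow_succ, Matrix.mul_apply]
    exact Finset.sum_nonneg fun k _ => mul_nonneg (ih i k) (hA k j)

/-- Uniformisation: the shift is a scalar matrix, hence commutes with everything and splits off as a
positive factor. The remaining exponential has a series with nonnegative terms when `0 ≤ t`, so any
single term bounds it from below. -/
theorem transMat_eq_shifted (Q : Matrix (Fin N) (Fin N) ℝ) (t : ℝ) (i j : Fin N) :
    transMat Q t i j = NormedSpace.exp (t • shifted Q) i j *
      Real.exp (-(t * shift Q)) := by
  have hd : (Matrix.diagonal fun _ : Fin N => -(t * shift Q)) =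
      (-(t * shift Q)) • (1 : Matrix (Fin N) (Fin N) ℝ) := by
    ext a b
    by_cases h : a = b <;> simp [Matrix.diagonal, h]
  have h1 : t • Q = t • shifted Q +
      Matrix.diagonal fun _ => -(t * shift Q) := by
    ext a b
    by_cases h : a = b
    · simp [shifted, h]
    · simp [shifted, Matrix.diagonal_apply_ne _ h]
  rw [transMat, h1, Matrix.exp_add_of_commute _ _ (by rw [hd]; exact (Commute.one_right _).smul_right _),
    Matrix.exp_diagonal, Matrix.mul_diagonal, Pi.coe_exp, Real.exp_eq_exp_ℝ]

theorem le_transMat_of_term (hQ : IsIrreducibleGenerator Q) {t : ℝ} (ht : 0 ≤ t) (n : ℕ)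
    (i j : Fin N) :
    ((n.factorial : ℝ)⁻¹ * ((t • shifted Q) ^ n) i j) *
      Real.exp (-(t * shift Q)) ≤ transMat Q t i j := by
  rw [transMat_eq_shifted]
  refine mul_le_mul_of_nonneg_right ?_ (Real.exp_pos _).le
  have hB : ∀ i j, 0 ≤ (t • shifted Q) i j := fun i j =>
    mul_nonneg ht (shift_nonneg hQ i j)
  have h1 := Pi.hasSum.1 (Pi.hasSum.1
    (hasSum_matrix_exp (t • shifted Q)) i) j
  exact le_hasSum h1 n fun m _ => mul_nonneg (by positivity) (pow_entry_nonneg hB m i j)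

theorem transMat_nonneg (hQ : IsIrreducibleGenerator Q) {t : ℝ} (ht : 0 ≤ t) (i j : Fin N) :
    0 ≤ transMat Q t i j := by
  refine le_trans ?_ (le_transMat_of_term hQ ht 0 i j)
  have : 0 ≤ (1 : Matrix (Fin N) (Fin N) ℝ) i j := by
    rw [Matrix.one_apply]; split_ifs <;> norm_num
  simp only [pow_zero]
  positivity

theorem transMat_le_one (hQ : IsIrreducibleGenerator Q) {t : ℝ} (ht : 0 ≤ t) (i j : Fin N) :
    transMat Q t i j ≤ 1 := by
  rw [← sum_transMat_apply hQ t i]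
  exact Finset.single_le_sum (fun k _ => transMat_nonneg hQ ht i k) (Finset.mem_univ j)

/-- Follow a path of positive rates, spending half of the remaining time on its last edge. The
zeroth series term handles staying put and the first one handles an edge. -/
theorem transMat_pos (hQ : IsIrreducibleGenerator Q) (i j : Fin N) {t : ℝ} (ht : 0 < t) :
    0 < transMat Q t i j := by
  induction hQ.irreducible i j generalizing t with
  | refl =>
    refine lt_of_lt_of_le ?_ (le_transMat_of_term hQ ht.le 0 i i)
    simp [Real.exp_pos]
  | @tail a b _ hab ih =>
    have h1 : 0 < transMat Q (t / 2) a b := by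
      -- The reachability relation does not exclude loops, for which the zeroth term suffices.
      by_cases h : a = b
      · subst h
        refine lt_of_lt_of_le ?_ (le_transMat_of_term hQ (half_pos ht).le 0 a a)
        simp [Real.exp_pos]
      · refine lt_of_lt_of_le ?_ (le_transMat_of_term hQ (half_pos ht).le 1 a b)
        simp only [Nat.factorial_one, Nat.cast_one, inv_one, one_mul, pow_one, Matrix.smul_apply,
          shifted, Matrix.add_apply, Matrix.diagonal_apply_ne _ h, add_zero, smul_eq_mul]
        have := Real.exp_pos (-(t / 2 * shift Q))
        have := half_pos ht
        positivity
    have h2 : transMat Q t i b = ∑ k, transMat Q (t / 2) i k * transMat Q (t / 2) k b := by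
      rw [← Matrix.mul_apply, ← transMat_add, add_halves]
    rw [h2]
    exact lt_of_lt_of_le (mul_pos (ih (half_pos ht)) h1) (Finset.single_le_sum
      (f := fun k => transMat Q (t / 2) i k * transMat Q (t / 2) k b)
      (fun k _ => mul_nonneg (transMat_nonneg hQ (half_pos ht).le i k)
        (transMat_nonneg hQ (half_pos ht).le k b)) (Finset.mem_univ a))

/-- A nonnegative matrix whose rows sum to `r` does not expand the `ℓ¹` norm by more than `r`. -/
theorem sum_abs_vecMul_le {M : Matrix (Fin N) (Fin N) ℝ} (hM : ∀ i j, 0 ≤ M i j) {r : ℝ}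
    (hr : ∀ i, ∑ j, M i j = r) (c : Fin N → ℝ) :
    ∑ j, |∑ i, c i * M i j| ≤ r * ∑ i, |c i| := by
  calc ∑ j, |∑ i, c i * M i j| ≤ ∑ j, ∑ i, |c i| * M i j := by
        refine Finset.sum_le_sum fun j _ => (Finset.abs_sum_le_sum_abs _ _).trans ?_
        refine Finset.sum_le_sum fun i _ => ?_
        rw [abs_mul, abs_of_nonneg (hM i j)]
    _ = r * ∑ i, |c i| := by
        rw [Finset.sum_comm, Finset.mul_sum]
        refine Finset.sum_congr rfl fun i _ => ?_
        rw [← Finset.mul_sum, hr, mul_comm]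

/-- Doeblin contraction for vectors of zero mass. -/
theorem sum_abs_vecMul_pow_le {M : Matrix (Fin N) (Fin N) ℝ} {δ : ℝ} (hM : ∀ i j, δ ≤ M i j)
    (hδ : 0 ≤ 1 - N * δ) (hr : ∀ i, ∑ j, M i j = 1) (n : ℕ) (c : Fin N → ℝ) (hc : ∑ i, c i = 0) :
    ∑ j, |∑ i, c i * (M ^ n) i j| ≤ (1 - N * δ) ^ n * ∑ i, |c i| := by
  induction n generalizing c with
  | zero => simp [Matrix.one_apply]
  | succ n ih =>
    have hz : ∑ j, ∑ i, c i * M i j = 0 := by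
      rw [Finset.sum_comm]
      simp [← Finset.mul_sum, hr, hc]
    have h1 := ih (fun j => ∑ i, c i * M i j) hz
    have h2 : ∑ j, |∑ i, c i * M i j| ≤ (1 - N * δ) * ∑ i, |c i| := by
      -- Subtracting `δ` from every entry keeps the matrix nonnegative, lowers the row sums to `1 -
      -- N * δ`, and does not change its action on `c`, which has zero mass.
      have := sum_abs_vecMul_le (M := fun i j => M i j - δ) (fun i j => sub_nonneg.2 (hM i j))
        (r := 1 - N * δ) (fun i => by simp [Finset.sum_sub_distrib, hr]) c
      simpa [mul_sub, Finset.sum_sub_distrib, ← Finset.sum_mul, hc] using this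
    have h3 : ∀ j, ∑ i, c i * (M ^ (n + 1)) i j =
        ∑ k, (∑ i, c i * M i k) * (M ^ n) k j := by
      intro j
      simp only [pow_succ', Matrix.mul_apply, Finset.mul_sum, Finset.sum_mul]
      rw [Finset.sum_comm]
      simp only [mul_assoc]
    simp only [h3]
    calc _ ≤ _ := h1
      _ ≤ (1 - N * δ) ^ n * ((1 - N * δ) * ∑ i, |c i|) := by gcongr
      _ = _ := by ring

/-- Split `t` into integer and fractional parts: the integer part contracts geometrically, with `δ`
the smallest entry of the transition matrix at time 1, and the fractional part does not expand the
`ℓ¹` norm. -/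
theorem tendsto_vecMul_transMat (hQ : IsIrreducibleGenerator Q) (c : Fin N → ℝ)
    (hc : ∑ i, c i = 0) :
    Tendsto (fun t : ℝ => ∑ j, |∑ i, c i * transMat Q t i j|) atTop (𝓝 0) := by
  rcases Nat.eq_zero_or_pos N with hN | hN
  · subst hN
    simp
  have : Nonempty (Fin N) := ⟨⟨0, hN⟩⟩
  obtain ⟨a, ha⟩ := Finite.exists_min fun q : Fin N × Fin N => transMat Q 1 q.1 q.2
  set δ := transMat Q 1 a.1 a.2 with hδ
  have hδ0 : 0 < δ := transMat_pos hQ _ _ one_pos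
  have hM : ∀ i j, δ ≤ transMat Q 1 i j := fun i j => ha (i, j)
  have hδ1 : 0 ≤ 1 - N * δ := by
    have := Finset.sum_le_sum (s := Finset.univ) fun j _ => hM a.1 j
    rw [sum_transMat_apply hQ] at this
    simp only [Finset.sum_const, Finset.card_univ, Fintype.card_fin, nsmul_eq_mul] at this
    linarith
  have hδ2 : 1 - N * δ < 1 := by
    have : (0 : ℝ) < N := Nat.cast_pos.2 hN
    have := mul_pos this hδ0
    linarith
  have hlim : Tendsto (fun t : ℝ => (1 - N * δ) ^ ⌊t⌋₊ * ∑ i, |c i|) atTop (𝓝 0) := by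
    have := ((tendsto_pow_atTop_nhds_zero_of_lt_one hδ1 hδ2).comp
      (tendsto_nat_floor_atTop (α := ℝ))).mul_const (∑ i, |c i|)
    simpa using this
  refine tendsto_of_tendsto_of_tendsto_of_le_of_le' tendsto_const_nhds hlim
    (Eventually.of_forall fun t => Finset.sum_nonneg fun _ _ => abs_nonneg _) ?_
  filter_upwards [eventually_ge_atTop 0] with t ht
  have hr : 0 ≤ t - ⌊t⌋₊ := sub_nonneg.2 (Nat.floor_le ht)
  have hsplit : ∀ j, ∑ i, c i * transMat Q t i j =
      ∑ k, (∑ i, c i * (transMat Q 1 ^ ⌊t⌋₊) i k) * transMat Q (t - ⌊t⌋₊) k j := by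
    intro j
    have : transMat Q t = transMat Q 1 ^ ⌊t⌋₊ * transMat Q (t - ⌊t⌋₊) := by
      rw [← transMat_natCast, ← transMat_add, add_sub_cancel]
    simp only [this, Matrix.mul_apply, Finset.mul_sum, Finset.sum_mul]
    rw [Finset.sum_comm]
    simp only [mul_assoc]
  simp only [hsplit]
  have h1 := sum_abs_vecMul_le (fun i j => transMat_nonneg hQ hr i j)
    (sum_transMat_apply hQ _) (fun k => ∑ i, c i * (transMat Q 1 ^ ⌊t⌋₊) i k)
  rw [one_mul] at h1
  exact h1.trans (sum_abs_vecMul_pow_le hM hδ1 (sum_transMat_apply hQ 1) _ c hc)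

end TransMat

/-! ### One- and two-time laws of the chain. -/

section Chain

variable {Ω : Type*} [MeasurableSpace Ω] {μ : Measure Ω} {N : ℕ}
  {Q : Matrix (Fin N) (Fin N) ℝ} {X : ℝ≥0 → Ω → Fin N}

theorem IsCTMC.two_point (hX : IsCTMC μ Q X) {s t : ℝ≥0} (hst : s ≤ t) (i j : Fin N) :
    μ.real {ω | X s ω = i ∧ X t ω = j} =
      μ.real {ω | X s ω = i} * transMat Q ((t : ℝ) - s) i j := by
  have hm : Monotone ![s, t] := by
    intro a b hab
    fin_cases a <;> fin_cases b <;> simp_all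
  have := hX.fdd 1 ![s, t] hm ![i, j]
  simpa [Fin.forall_fin_two] using this

theorem IsCTMC.marginal [IsProbabilityMeasure μ] (hX : IsCTMC μ Q X) (t : ℝ≥0) (j : Fin N) :
    μ.real {ω | X t ω = j} = ∑ i, μ.real {ω | X 0 ω = i} * transMat Q t i j := by
  have h1 : {ω | X t ω = j} = ⋃ i ∈ (Finset.univ : Finset (Fin N)), {ω | X 0 ω = i ∧ X t ω = j} := by
    ext ω
    simp
  rw [h1, measureReal_biUnion_finset]
  · refine Finset.sum_congr rfl fun i _ => ?_
    rw [hX.two_point zero_le]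
    simp
  · intro a _ b _ hab
    refine Set.disjoint_left.2 fun ω h1 h2 => hab (h1.1.symm.trans h2.1)
  · intro i _
    exact (hX.measurable 0 (measurableSet_singleton i)).inter
      (hX.measurable t (measurableSet_singleton j))

theorem IsCTMC.sum_marginal [IsProbabilityMeasure μ] (hX : IsCTMC μ Q X) (t : ℝ≥0) :
    ∑ i, μ.real {ω | X t ω = i} = 1 := by
  rw [← measureReal_biUnion_finset]
  · have : (⋃ i ∈ (Finset.univ : Finset (Fin N)), {ω | X t ω = i}) = Set.univ := by ext; simp
    rw [this, probReal_univ]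
  · intro a _ b _ hab
    exact Set.disjoint_left.2 fun ω h1 h2 => hab (Eq.trans (Eq.symm h1) h2)
  · intro i _
    exact hX.measurable t (measurableSet_singleton i)

/-- The `ℓ¹` distance between the law of the chain at time `t` and `p`. -/
def distToStationary (μ : Measure Ω) (X : ℝ≥0 → Ω → Fin N) (p : Fin N → ℝ) (t : ℝ≥0) : ℝ :=
  ∑ i, |μ.real {ω | X t ω = i} - p i|

theorem IsCTMC.tendsto_distToStationary [IsProbabilityMeasure μ] (hQ : IsIrreducibleGenerator Q)
    (hX : IsCTMC μ Q X) {p : Fin N → ℝ} (hp : IsStationaryDist Q p) :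
    Tendsto (distToStationary μ X p) atTop (𝓝 0) := by
  have h := (tendsto_vecMul_transMat hQ (fun i => μ.real {ω | X 0 ω = i} - p i)
    (by rw [Finset.sum_sub_distrib, hX.sum_marginal, hp.sum_eq_one, sub_self])).comp
      (NNReal.tendsto_coe_atTop.2 tendsto_id)
  refine h.congr fun t => ?_
  simp only [Function.comp, distToStationary]
  refine Finset.sum_congr rfl fun j _ => ?_
  simp only [sub_mul, Finset.sum_sub_distrib]
  rw [hX.marginal t j]
  congr 2
  exact hp.invariant t t.2 j

end Chain

/-! ### Right-continuous paths and joint measurability. -/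

/-- The space of right-continuous paths with values in `Fin N`. -/
abbrev RCPath (N : ℕ) : Type := {x : ℝ≥0 → Fin N // ∀ t, ∀ᶠ s in 𝓝[≥] t, x s = x t}

/-- The `k`-th point of the grid of mesh `1 / (n + 1)`. -/
def ceilGrid (n k : ℕ) : ℝ≥0 := (k : ℝ≥0) / (n + 1)

theorem tendsto_ceilGrid (t : ℝ≥0) :
    Tendsto (fun n : ℕ => ceilGrid n ⌈t * (n + 1)⌉₊) atTop (𝓝[≥] t) := by
  have hle : ∀ n : ℕ, t ≤ ceilGrid n ⌈t * (n + 1)⌉₊ := fun n => by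
    rw [ceilGrid, le_div_iff₀ (by positivity)]
    exact Nat.le_ceil _
  refine tendsto_nhdsWithin_iff.2 ⟨?_, Eventually.of_forall hle⟩
  refine tendsto_of_tendsto_of_tendsto_of_le_of_le (g := fun _ : ℕ => t)
    (h := fun n : ℕ => t + 1 / ((n : ℝ≥0) + 1)) tendsto_const_nhds ?_ hle fun n => ?_
  · have : Tendsto (fun n : ℕ => 1 / ((n : ℝ≥0) + 1)) atTop (𝓝 0) :=
      tendsto_one_div_add_atTop_nhds_zero_nat
    simpa using this.const_add t
  · have h0 : (0 : ℝ≥0) < n + 1 := by positivity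
    change ceilGrid n _ ≤ t + 1 / ((n : ℝ≥0) + 1)
    rw [ceilGrid, div_le_iff₀ h0, add_mul, one_div, inv_mul_cancel₀ h0.ne']
    exact (Nat.ceil_lt_add_one zero_le).le

theorem RCPath.measurable_eval {N : ℕ} (t : ℝ≥0) : Measurable fun x : RCPath N => x.1 t :=
  (measurable_pi_apply t).comp measurable_subtype_coe

/-- Rounding the time up to a grid leaves countably many evaluations, each measurable. The grid
points approach from the right, so by right-continuity the rounded values are eventually equal to
the true one. -/
theorem RCPath.measurable_uncurry {N : ℕ} :
    Measurable fun q : RCPath N × ℝ≥0 => q.1.1 q.2 := by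
  refine measurable_of_tendsto_metrizable
    (f := fun (n : ℕ) (q : RCPath N × ℝ≥0) => q.1.1 (ceilGrid n ⌈q.2 * (n + 1)⌉₊)) (fun n => ?_) ?_
  · have h1 : Measurable fun r : RCPath N × ℕ => r.1.1 (ceilGrid n r.2) :=
      measurable_from_prod_countable_left fun k => RCPath.measurable_eval (ceilGrid n k)
    have h2 : Measurable fun q : RCPath N × ℝ≥0 => (q.1, ⌈q.2 * (n + 1)⌉₊) :=
      measurable_fst.prodMk (Nat.measurable_ceil.comp (measurable_snd.mul_const _))
    exact h1.comp h2
  · refine tendsto_pi_nhds.2 fun q => ?_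
    refine tendsto_const_nhds.congr' ?_
    filter_upwards [(tendsto_ceilGrid q.2).eventually (q.1.2 q.2)] with n hn using hn.symm

/-- The delays of one realisation: `Sum.inl k` forward, `Sum.inr k` backward. -/
abbrev Delays : Type := ℕ ⊕ ℕ → ℝ≥0

/-! ### The zero-wait timetable and estimate as functions of the delays. -/

namespace Delays

/-- The time at which query `k` is sent under the zero-wait policy. -/
def send (q : Delays) (k : ℕ) : ℝ≥0 := ∑ j ∈ Finset.range k, (q (Sum.inl j) + q (Sum.inr j))

/-- The time at which query `k` reaches the source under the zero-wait policy. -/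
def sample (q : Delays) (k : ℕ) : ℝ≥0 := send q k + q (Sum.inl k)

/-- The index of the last reply received up to time `t`. -/
def last (q : Delays) (t : ℝ≥0) : ℕ := sSup {k | send q (k + 1) ≤ t}

theorem send_succ (q : Delays) (k : ℕ) :
    send q (k + 1) = send q k + q (Sum.inl k) + q (Sum.inr k) := by
  rw [send, Finset.sum_range_succ, ← send, add_assoc]

theorem send_mono (q : Delays) : Monotone (send q) :=
  monotone_nat_of_le_succ fun k => by rw [send_succ, add_assoc]; exact le_self_add

theorem last_eq_of_mem {q : Delays} {t : ℝ≥0} {k : ℕ} (h1 : send q (k + 1) ≤ t)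
    (h2 : t < send q (k + 2)) : last q t = k := by
  have hub : ∀ j ∈ {k | send q (k + 1) ≤ t}, j ≤ k := by
    intro j hj
    by_contra h
    exact absurd ((send_mono q (show k + 2 ≤ j + 1 by omega)).trans hj) (not_le.2 h2)
  exact le_antisymm (csSup_le ⟨k, h1⟩ hub) (le_csSup ⟨k, hub⟩ h1)

/-- The supremum of an empty or of an unbounded set of naturals is `0`, so only a nonzero value
certifies that the set is nonempty and bounded. -/
theorem last_eq_iff {q : Delays} {t : ℝ≥0} {k : ℕ} (hk : k ≠ 0) :
    last q t = k ↔ send q (k + 1) ≤ t ∧ t < send q (k + 2) := by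
  refine ⟨fun h => ?_, fun h => last_eq_of_mem h.1 h.2⟩
  have hne : {k | send q (k + 1) ≤ t}.Nonempty := by
    by_contra hne
    rw [Set.not_nonempty_iff_eq_empty] at hne
    exact hk (by rw [← h, last, hne]; simp)
  have hb : BddAbove {k | send q (k + 1) ≤ t} := by
    by_contra hb
    exact hk (by rw [← h, last]; exact Nat.sSup_of_not_bddAbove hb)
  constructor
  · have := Nat.sSup_mem hne hb
    rwa [← last, h] at this
  · by_contra hlt
    have : k + 1 ≤ last q t := le_csSup hb (show send q (k + 1 + 1) ≤ t from not_lt.1 hlt)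
    omega

theorem measurable_send (k : ℕ) : Measurable fun q : Delays => send q k :=
  Finset.measurable_fun_sum _ fun _ _ => (measurable_pi_apply _).add (measurable_pi_apply _)

theorem measurable_sample (k : ℕ) : Measurable fun q : Delays => sample q k :=
  (measurable_send k).add (measurable_pi_apply _)

theorem measurable_last : Measurable fun r : Delays × ℝ≥0 => last r.1 r.2 := by
  have hpos : ∀ k : ℕ, k ≠ 0 →
      MeasurableSet ((fun r : Delays × ℝ≥0 => last r.1 r.2) ⁻¹' {k}) := by
    intro k hk
    have : (fun r : Delays × ℝ≥0 => last r.1 r.2) ⁻¹' {k} =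
        {r | send r.1 (k + 1) ≤ r.2} ∩ {r | r.2 < send r.1 (k + 2)} := by
      ext r
      exact last_eq_iff hk
    rw [this]
    exact (measurableSet_le ((measurable_send _).comp measurable_fst) measurable_snd).inter
      (measurableSet_lt measurable_snd ((measurable_send _).comp measurable_fst))
  refine measurable_to_countable' fun k => ?_
  rcases eq_or_ne k 0 with rfl | hk
  -- The value `0` also absorbs the degenerate cases, so its preimage is obtained as the complement
  -- of all the others.
  · have : (fun r : Delays × ℝ≥0 => last r.1 r.2) ⁻¹' {0} =
        (⋃ k : ℕ, (fun r : Delays × ℝ≥0 => last r.1 r.2) ⁻¹' {k + 1})ᶜ := by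
      ext r
      simp only [Set.mem_preimage, Set.mem_singleton_iff, Set.mem_compl_iff, Set.mem_iUnion,
        not_exists]
      exact ⟨fun h k => by omega, fun h => by
        by_contra h0
        exact h (last r.1 r.2 - 1) (by omega)⟩
    rw [this]
    exact (MeasurableSet.iUnion fun k => hpos _ (Nat.succ_ne_zero k)).compl
  · exact hpos k hk

theorem measurable_sample_last : Measurable fun r : Delays × ℝ≥0 => sample r.1 (last r.1 r.2) := by
  have h1 : Measurable fun r : Delays × ℕ => sample r.1 r.2 :=
    measurable_from_prod_countable_left fun k => measurable_sample k
  exact h1.comp (measurable_fst.prodMk measurable_last)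

/-- The estimate of the monitor, as a function of the path and of the delays. -/
def estimate {N : ℕ} (e : Fin N → ℝ≥0 → Fin N) (x₀ : Fin N) (x : RCPath N) (q : Delays)
    (t : ℝ≥0) : Fin N :=
  if t < send q 1 then x₀ else e (x.1 (sample q (last q t))) (t - sample q (last q t))

variable {N : ℕ} {e : Fin N → ℝ≥0 → Fin N}

theorem measurable_uncurry_estimator (he : ∀ i, Measurable (e i)) :
    Measurable fun r : Fin N × ℝ≥0 => e r.1 r.2 :=
  measurable_from_prod_countable_right he

theorem measurable_estimate (he : ∀ i, Measurable (e i)) (x₀ : Fin N) :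
    Measurable fun r : RCPath N × (Delays × ℝ≥0) => estimate e x₀ r.1 r.2.1 r.2.2 := by
  have hs : Measurable fun r : RCPath N × (Delays × ℝ≥0) => sample r.2.1 (last r.2.1 r.2.2) :=
    measurable_sample_last.comp measurable_snd
  have ht : Measurable fun r : RCPath N × (Delays × ℝ≥0) => r.2.2 :=
    measurable_snd.comp measurable_snd
  refine Measurable.ite ?_ measurable_const ?_
  · exact measurableSet_lt ht ((measurable_send 1).comp (measurable_fst.comp measurable_snd))
  · exact (measurable_uncurry_estimator he).comp
      ((RCPath.measurable_uncurry.comp (measurable_fst.prodMk hs)).prodMk (ht.sub hs))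

/-- The indicator that the estimate is fresh. -/
def fresh (e : Fin N → ℝ≥0 → Fin N) (x₀ : Fin N) (x : RCPath N) (q : Delays) (t : ℝ≥0) : ℝ :=
  if x.1 t = estimate e x₀ x q t then 1 else 0

theorem measurable_fresh (he : ∀ i, Measurable (e i)) (x₀ : Fin N) :
    Measurable fun r : RCPath N × (Delays × ℝ≥0) => fresh e x₀ r.1 r.2.1 r.2.2 :=
  Measurable.ite (measurableSet_eq_fun
    (RCPath.measurable_uncurry.comp (measurable_fst.prodMk (measurable_snd.comp measurable_snd)))
    (measurable_estimate he x₀)) measurable_const measurable_const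

theorem fresh_nonneg (x₀ : Fin N) (x : RCPath N) (q : Delays) (t : ℝ≥0) :
    0 ≤ fresh e x₀ x q t := by
  rw [fresh]; split_ifs <;> norm_num

theorem fresh_le_one (x₀ : Fin N) (x : RCPath N) (q : Delays) (t : ℝ≥0) :
    fresh e x₀ x q t ≤ 1 := by
  rw [fresh]; split_ifs <;> norm_num

end Delays

/-! ### Freezing the delays and averaging over the path. -/

section Transfer

variable {Ω : Type*} {N : ℕ}

/-- Without waiting the right-hand side does not involve `X`: this is what makes the sampling times
deterministic once the delays are frozen. -/
theorem sendTime_zeroWait (X : ℝ≥0 → Ω → Fin N) (Y D : ℕ → Ω → ℝ≥0) (k : ℕ) (ω : Ω) :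
    sendTime (zeroWait N) X Y D k ω = Delays.send (fun s => Sum.elim Y D s ω) k := by
  induction k with
  | zero => simp [sendTime, Delays.send]
  | succ k ih => rw [sendTime, Delays.send_succ, ih]; simp [zeroWait]

theorem receiptTime_zeroWait (X : ℝ≥0 → Ω → Fin N) (Y D : ℕ → Ω → ℝ≥0) (k : ℕ) (ω : Ω) :
    receiptTime (zeroWait N) X Y D k ω = Delays.send (fun s => Sum.elim Y D s ω) (k + 1) := by
  rw [receiptTime, sampleTime, sendTime_zeroWait, Delays.send_succ]
  rfl

variable [MeasurableSpace Ω] {μ : Measure Ω} {Q : Matrix (Fin N) (Fin N) ℝ} {X : ℝ≥0 → Ω → Fin N}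

/-- The path of the chain. -/
def IsCTMC.path (hX : IsCTMC μ Q X) (ω : Ω) : RCPath N := ⟨fun t => X t ω, hX.rightCts ω⟩

theorem IsCTMC.measurable_path (hX : IsCTMC μ Q X) : Measurable hX.path :=
  Measurable.subtype_mk (measurable_pi_lambda _ hX.measurable)

theorem estimate_zeroWait (hX : IsCTMC μ Q X) (e : Fin N → ℝ≥0 → Fin N) (x₀ : Fin N)
    (Y D : ℕ → Ω → ℝ≥0) (t : ℝ≥0) (ω : Ω) :
    estimate e x₀ (zeroWait N) X Y D t ω =
      Delays.estimate e x₀ (hX.path ω) (fun s => Sum.elim Y D s ω) t := by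
  simp only [estimate, Delays.estimate, lastReply, sampleTime, receiptTime_zeroWait,
    sendTime_zeroWait]
  rfl

variable {νY νD : Measure ℝ≥0} {Y D : ℕ → Ω → ℝ≥0}

theorem IsDelaySystem.measurable_sum (hYD : IsDelaySystem μ X νY νD Y D) (s : ℕ ⊕ ℕ) :
    Measurable (Sum.elim Y D s) := by
  cases s with
  | inl k => exact hYD.measurable_forward k
  | inr k => exact hYD.measurable_backward k

theorem IsDelaySystem.measurable_delays (hYD : IsDelaySystem μ X νY νD Y D) :
    Measurable fun ω s => Sum.elim Y D s ω :=
  measurable_pi_lambda _ hYD.measurable_sum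

theorem IsDelaySystem.indep_path (hX : IsCTMC μ Q X) (hYD : IsDelaySystem μ X νY νD Y D) :
    IndepFun hX.path (fun ω s => Sum.elim Y D s ω) μ := by
  have h := hYD.indep_source
  rw [IndepFun_iff_Indep] at h ⊢
  have : MeasurableSpace.comap hX.path inferInstance =
      MeasurableSpace.comap (fun ω t => X t ω) inferInstance := by
    change MeasurableSpace.comap hX.path (MeasurableSpace.comap Subtype.val MeasurableSpace.pi) = _
    rw [MeasurableSpace.comap_comp]
    rfl
  rw [this]
  exact h

/-- The probability that the estimate is fresh at time `t`, given the delays `q`. -/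
def IsCTMC.freshProb (hX : IsCTMC μ Q X) (e : Fin N → ℝ≥0 → Fin N) (x₀ : Fin N) (q : Delays)
    (t : ℝ≥0) : ℝ :=
  ∫ ω, Delays.fresh e x₀ (hX.path ω) q t ∂μ

variable {e : Fin N → ℝ≥0 → Fin N} {x₀ : Fin N}

theorem IsCTMC.measurable_freshProb [IsProbabilityMeasure μ] (hX : IsCTMC μ Q X)
    (he : ∀ i, Measurable (e i)) :
    Measurable fun r : Delays × ℝ≥0 => hX.freshProb e x₀ r.1 r.2 := by
  have h : Measurable (Function.uncurry fun (r : Delays × ℝ≥0) (ω : Ω) =>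
      Delays.fresh e x₀ (hX.path ω) r.1 r.2) :=
    (Delays.measurable_fresh he x₀).comp
      ((hX.measurable_path.comp measurable_snd).prodMk measurable_fst)
  exact (h.stronglyMeasurable.integral_prod_right).measurable

theorem IsCTMC.freshProb_nonneg (hX : IsCTMC μ Q X) (q : Delays) (t : ℝ≥0) :
    0 ≤ hX.freshProb e x₀ q t :=
  integral_nonneg fun _ => Delays.fresh_nonneg _ _ _ _

theorem IsCTMC.freshProb_le_one [IsProbabilityMeasure μ] (hX : IsCTMC μ Q X) (q : Delays)
    (t : ℝ≥0) : hX.freshProb e x₀ q t ≤ 1 := by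
  have := integral_mono_of_nonneg (μ := μ)
    (Eventually.of_forall fun ω => Delays.fresh_nonneg (e := e) x₀ (hX.path ω) q t)
    (integrable_const (1 : ℝ))
    (Eventually.of_forall fun ω => Delays.fresh_le_one (e := e) x₀ (hX.path ω) q t)
  exact this.trans_eq (by simp)

/-- By independence the joint law of path and delays is a product. Fubini integrates out the path
for fixed delays, and a second swap moves that integral inside the time integral. -/
theorem IsDelaySystem.integral_fresh [IsProbabilityMeasure μ] (hX : IsCTMC μ Q X)
    (hYD : IsDelaySystem μ X νY νD Y D) (he : ∀ i, Measurable (e i)) {T : ℝ} (hT : 0 ≤ T) :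
    ∫ ω, (∫ t in (0 : ℝ)..T,
        if X t.toNNReal ω = estimate e x₀ (zeroWait N) X Y D t.toNNReal ω then (1 : ℝ) else 0) ∂μ =
      ∫ ω, (∫ t in (0 : ℝ)..T,
        hX.freshProb e x₀ (fun s => Sum.elim Y D s ω) t.toNNReal) ∂μ := by
  set q : Ω → Delays := fun ω s => Sum.elim Y D s ω with hq
  have hqm : Measurable q := hYD.measurable_delays
  have hpm := hX.measurable_path
  have hmap := (indepFun_iff_map_prod_eq_prod_map_map hpm.aemeasurable hqm.aemeasurable).1
    (hYD.indep_path hX)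
  have : IsProbabilityMeasure (μ.map hX.path) := Measure.isProbabilityMeasure_map hpm.aemeasurable
  have : IsProbabilityMeasure (μ.map q) := Measure.isProbabilityMeasure_map hqm.aemeasurable
  have hfm : Measurable fun r : (RCPath N × Delays) × ℝ =>
      Delays.fresh e x₀ r.1.1 r.1.2 r.2.toNNReal :=
    (Delays.measurable_fresh he x₀).comp ((measurable_fst.comp measurable_fst).prodMk
      ((measurable_snd.comp measurable_fst).prodMk (measurable_real_toNNReal.comp measurable_snd)))
  have hbd : ∀ x (q : Delays) t, ‖Delays.fresh e x₀ x q t‖ ≤ 1 := fun x q t => by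
    rw [Real.norm_of_nonneg (Delays.fresh_nonneg _ _ _ _)]
    exact Delays.fresh_le_one _ _ _ _
  have hGm : StronglyMeasurable fun r : RCPath N × Delays =>
      ∫ t in Set.Ioc 0 T, Delays.fresh e x₀ r.1 r.2 t.toNNReal :=
    StronglyMeasurable.integral_prod_right
      (f := fun (r : RCPath N × Delays) (t : ℝ) => Delays.fresh e x₀ r.1 r.2 t.toNNReal)
      hfm.stronglyMeasurable
  have hGi : Integrable (fun r : RCPath N × Delays =>
      ∫ t in Set.Ioc 0 T, Delays.fresh e x₀ r.1 r.2 t.toNNReal)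
      ((μ.map hX.path).prod (μ.map q)) := by
    refine Integrable.of_bound hGm.aestronglyMeasurable (1 * volume.real (Set.Ioc 0 T))
      (Eventually.of_forall fun r => ?_)
    exact norm_setIntegral_le_of_norm_le_const (by simp) fun t _ => hbd _ _ _
  calc _ = ∫ ω, (fun r : RCPath N × Delays =>
        ∫ t in Set.Ioc 0 T, Delays.fresh e x₀ r.1 r.2 t.toNNReal) (hX.path ω, q ω) ∂μ := by
        refine integral_congr_ae (Eventually.of_forall fun ω => ?_)
        simp only [intervalIntegral.integral_of_le hT, estimate_zeroWait hX]
        rfl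
    _ = ∫ r, (∫ t in Set.Ioc 0 T, Delays.fresh e x₀ r.1 r.2 t.toNNReal)
          ∂((μ.map hX.path).prod (μ.map q)) := by
        rw [← hmap, integral_map (hpm.prodMk hqm).aemeasurable hGm.aestronglyMeasurable]
    _ = ∫ q', ∫ x, (∫ t in Set.Ioc 0 T, Delays.fresh e x₀ x q' t.toNNReal)
          ∂(μ.map hX.path) ∂(μ.map q) := integral_prod_symm _ hGi
    _ = ∫ q', (∫ t in Set.Ioc 0 T, hX.freshProb e x₀ q' t.toNNReal) ∂(μ.map q) := by
        refine integral_congr_ae (Eventually.of_forall fun q' => ?_)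
        dsimp only
        rw [integral_integral_swap]
        · refine integral_congr_ae (Eventually.of_forall fun t => ?_)
          dsimp only
          rw [IsCTMC.freshProb, integral_map hpm.aemeasurable]
          exact (hfm.comp ((measurable_id.prodMk measurable_const).prodMk
            measurable_const)).aestronglyMeasurable
        · refine Integrable.of_bound (C := 1) ?_ (Eventually.of_forall fun r => hbd _ _ _)
          exact (hfm.comp ((measurable_fst.prodMk measurable_const).prodMk
            measurable_snd)).aestronglyMeasurable
    _ = _ := by
        rw [integral_map hqm.aemeasurable]
        · simp only [intervalIntegral.integral_of_le hT, hq]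
        · refine (StronglyMeasurable.integral_prod_right
            (f := fun (q' : Delays) (t : ℝ) => hX.freshProb e x₀ q' t.toNNReal)
            ?_).aestronglyMeasurable
          exact ((hX.measurable_freshProb he).comp (measurable_fst.prodMk
            (measurable_real_toNNReal.comp measurable_snd))).stronglyMeasurable

/-- The probability that the estimate is fresh when the last received state is `i`, of age `a`. -/
def freshKernel (Q : Matrix (Fin N) (Fin N) ℝ) (e : Fin N → ℝ≥0 → Fin N) (i : Fin N) (a : ℝ≥0) :
    ℝ := transMat Q a i (e i a)

theorem freshKernel_nonneg (hQ : IsIrreducibleGenerator Q) (i : Fin N) (a : ℝ≥0) :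
    0 ≤ freshKernel Q e i a := transMat_nonneg hQ a.2 _ _

theorem freshKernel_le_one (hQ : IsIrreducibleGenerator Q) (i : Fin N) (a : ℝ≥0) :
    freshKernel Q e i a ≤ 1 := transMat_le_one hQ a.2 _ _

theorem measurable_freshKernel (he : ∀ i, Measurable (e i)) (i : Fin N) :
    Measurable (freshKernel Q e i) := by
  have h1 : Measurable fun r : Fin N × ℝ≥0 => transMat Q r.2 i r.1 :=
    measurable_from_prod_countable_right fun j =>
      ((continuous_transMat_apply Q i j).measurable.comp measurable_coe_nnreal_real)
  exact h1.comp ((he i).prodMk measurable_id)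

/-- Reply `k` is the one in use, so split according to the state sampled at the now deterministic
time and apply the two-time law. -/
theorem IsCTMC.freshProb_eq [IsProbabilityMeasure μ] (hX : IsCTMC μ Q X) {q : Delays} {t : ℝ≥0}
    {k : ℕ} (h1 : Delays.send q (k + 1) ≤ t) (h2 : t < Delays.send q (k + 2)) :
    hX.freshProb e x₀ q t = ∑ i, μ.real {ω | X (Delays.sample q k) ω = i} *
      freshKernel Q e i (t - Delays.sample q k) := by
  have hlast := Delays.last_eq_of_mem h1 h2
  have hst : Delays.sample q k ≤ t := by
    refine le_trans ?_ h1
    rw [Delays.send_succ]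
    exact le_self_add
  set s := Delays.sample q k with hs
  have h0 : ¬ t < Delays.send q 1 :=
    not_lt.2 ((Delays.send_mono q (show 1 ≤ k + 1 by omega)).trans h1)
  have hset : ∀ i j, MeasurableSet {ω | X s ω = i ∧ X t ω = j} := fun i j =>
    (hX.measurable s (measurableSet_singleton i)).inter
      (hX.measurable t (measurableSet_singleton j))
  have hf : ∀ ω, Delays.fresh e x₀ (hX.path ω) q t =
      ∑ i, Set.indicator {ω | X s ω = i ∧ X t ω = e i (t - s)} (fun _ => (1 : ℝ)) ω := by
    intro ω
    rw [Finset.sum_eq_single (X s ω)]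
    · simp [Delays.fresh, Delays.estimate, h0, hlast, ← hs, IsCTMC.path, Set.indicator_apply]
    · intro i _ hi
      exact Set.indicator_of_notMem (fun h => hi h.1.symm) _
    · simp
  rw [IsCTMC.freshProb]
  simp only [hf]
  rw [integral_finsetSum _ fun i _ => (integrable_const _).indicator (hset _ _)]
  refine Finset.sum_congr rfl fun i _ => ?_
  rw [integral_indicator_const _ (hset _ _), hX.two_point hst, freshKernel, NNReal.coe_sub hst]
  simp

/-- The kernel takes values in `[0, 1]`, which makes the bound uniform over the ages within the
cycle. -/
theorem IsCTMC.abs_freshProb_sub_le [IsProbabilityMeasure μ] (hQ : IsIrreducibleGenerator Q)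
    (hX : IsCTMC μ Q X) (p : Fin N → ℝ) {q : Delays} {t : ℝ≥0}
    {k : ℕ} (h1 : Delays.send q (k + 1) ≤ t) (h2 : t < Delays.send q (k + 2)) :
    |hX.freshProb e x₀ q t - ∑ i, p i * freshKernel Q e i (t - Delays.sample q k)| ≤
      distToStationary μ X p (Delays.sample q k) := by
  rw [hX.freshProb_eq h1 h2, ← Finset.sum_sub_distrib]
  refine (Finset.abs_sum_le_sum_abs _ _).trans (Finset.sum_le_sum fun i _ => ?_)
  rw [← sub_mul, abs_mul, abs_of_nonneg (freshKernel_nonneg hQ _ _)]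
  exact mul_le_of_le_one_right (abs_nonneg _) (freshKernel_le_one hQ _ _)

end Transfer

/-! ### Deterministic renewal-reward limits. -/

theorem tendsto_natCast_succ_div : Tendsto (fun n : ℕ => ((n : ℝ) + 1) / n) atTop (𝓝 1) := by
  have h : Tendsto (fun n : ℕ => 1 + 1 / (n : ℝ)) atTop (𝓝 (1 + 0)) :=
    tendsto_const_nhds.add tendsto_one_div_atTop_nhds_zero_nat
  rw [add_zero] at h
  refine h.congr' ?_
  filter_upwards [eventually_gt_atTop 0] with n hn
  have : (n : ℝ) ≠ 0 := by positivity
  field_simp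

theorem tendsto_div_natCast_succ_iff {u : ℕ → ℝ} {a : ℝ} :
    Tendsto (fun n : ℕ => u (n + 1) / n) atTop (𝓝 a) ↔
      Tendsto (fun n : ℕ => u n / n) atTop (𝓝 a) := by
  rw [← tendsto_add_atTop_iff_nat (f := fun n : ℕ => u n / n) 1]
  constructor
  · intro h
    have := h.div tendsto_natCast_succ_div one_ne_zero
    rw [div_one] at this
    refine this.congr' ?_
    filter_upwards [eventually_gt_atTop 0] with n hn
    have : (n : ℝ) ≠ 0 := by positivity
    simp only [Nat.cast_add, Nat.cast_one, Pi.div_apply]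
    field_simp
  · intro h
    have := h.mul tendsto_natCast_succ_div
    rw [mul_one] at this
    refine this.congr' ?_
    filter_upwards [eventually_gt_atTop 0] with n hn
    have : (n : ℝ) ≠ 0 := by positivity
    simp only [Nat.cast_add, Nat.cast_one]
    field_simp

theorem tendsto_atTop_of_div_natCast {s : ℕ → ℝ} {m : ℝ} (hm : 0 < m)
    (hs : Tendsto (fun n : ℕ => s n / n) atTop (𝓝 m)) : Tendsto s atTop atTop := by
  refine (hs.pos_mul_atTop hm tendsto_natCast_atTop_atTop).congr' ?_
  filter_upwards [eventually_gt_atTop 0] with n hn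
  have : (n : ℝ) ≠ 0 := by positivity
  field_simp

/-- Averages of a monotone function along renewal times determine its long-run average. -/
theorem tendsto_div_of_tendsto_renewal {F : ℝ → ℝ} (hF : MonotoneOn F (Set.Ici 0)) (hF0 : F 0 = 0)
    {s : ℕ → ℝ} (hs0 : s 0 = 0) (hsm : Monotone s) {m ρ : ℝ} (hm : 0 < m)
    (hs : Tendsto (fun n : ℕ => s n / n) atTop (𝓝 m))
    (hFs : Tendsto (fun n : ℕ => F (s n) / n) atTop (𝓝 ρ)) :
    Tendsto (fun T => F T / T) atTop (𝓝 (ρ / m)) := by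
  have hst := tendsto_atTop_of_div_natCast hm hs
  have hsnn : ∀ n, 0 ≤ s n := fun n => hs0 ▸ hsm (Nat.zero_le n)
  have hFnn : ∀ T, 0 ≤ T → 0 ≤ F T := fun T hT => hF0 ▸ hF Set.self_mem_Ici hT hT
  -- `n T` will be the cycle containing `T`; the condition `0 ≤ T` sits under the quantifier so that
  -- the choice is defined for every real `T`.
  have hex : ∀ T : ℝ, ∃ n, 0 ≤ T → s n ≤ T ∧ T < s (n + 1) := by
    intro T
    by_cases hT : 0 ≤ T
    · classical
      have h : ∃ n, T < s n := (hst.eventually_gt_atTop T).exists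
      have h0 : Nat.find h ≠ 0 := fun h0 => by
        have := Nat.find_spec h
        rw [h0, hs0] at this
        exact absurd hT (not_le.2 this)
      obtain ⟨k, hk⟩ := Nat.exists_eq_succ_of_ne_zero h0
      refine ⟨k, fun _ => ⟨not_lt.1 (Nat.find_min h (by omega)), ?_⟩⟩
      have := Nat.find_spec h
      rwa [hk] at this
    · exact ⟨0, fun h => absurd h hT⟩
  choose n hn using hex
  have hnt : Tendsto n atTop atTop := by
    refine tendsto_atTop.2 fun K => ?_
    filter_upwards [eventually_ge_atTop (s K)] with T hT
    by_contra hlt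
    have h1 := (hn T ((hsnn K).trans hT)).2
    have h2 := hsm (show n T + 1 ≤ K by omega)
    linarith
  -- Monotonicity gives `F (s n) / s (n + 1) ≤ F T / T ≤ F (s (n + 1)) / s n` for the cycle `n`
  -- containing `T`; both bounds have limit `ρ / m`.
  have hup : Tendsto (fun k : ℕ => F (s (k + 1)) / s k) atTop (𝓝 (ρ / m)) := by
    refine ((tendsto_div_natCast_succ_iff (u := fun k => F (s k))).2 hFs |>.div hs hm.ne').congr' ?_
    filter_upwards [eventually_gt_atTop 0] with k hk
    have : (k : ℝ) ≠ 0 := by positivity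
    simp only [Pi.div_apply]
    field_simp
  have hlo : Tendsto (fun k : ℕ => F (s k) / s (k + 1)) atTop (𝓝 (ρ / m)) := by
    refine (hFs.div ((tendsto_div_natCast_succ_iff (u := s)).2 hs) hm.ne').congr' ?_
    filter_upwards [eventually_gt_atTop 0] with k hk
    have : (k : ℝ) ≠ 0 := by positivity
    simp only [Pi.div_apply]
    field_simp
  refine tendsto_of_tendsto_of_tendsto_of_le_of_le' (hlo.comp hnt) (hup.comp hnt) ?_ ?_
  · filter_upwards [eventually_gt_atTop 0] with T hT
    obtain ⟨h1, h2⟩ := hn T hT.le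
    exact div_le_div₀ (hFnn T hT.le) (hF (hsnn _) hT.le h1) hT h2.le
  · filter_upwards [eventually_gt_atTop 0,
      (hst.comp hnt).eventually_gt_atTop 0] with T hT hpos
    obtain ⟨h1, h2⟩ := hn T hT.le
    exact div_le_div₀ (hFnn _ (hsnn _)) (hF hT.le (hsnn _) h2.le) hpos h1

namespace Delays

/-- The freshness collected between two receptions, when a reply of age `d` has freshness `h` as a
function of its age and is used for the time `z`. -/
def reward (h : ℝ≥0 → ℝ) (d z : ℝ≥0) : ℝ := ∫ u in (0 : ℝ)..z, h (u.toNNReal + d)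

/-- Measure time from the receipt of reply `k`, when its age is the backward delay of query `k`; the
next receipt comes one full forward and backward delay later. -/
theorem integral_age_eq_reward (h : ℝ≥0 → ℝ) (q : Delays) (k : ℕ) :
    ∫ t in (send q (k + 1) : ℝ)..(send q (k + 2) : ℝ), h (t.toNNReal - sample q k) =
      reward h (q (Sum.inr k)) (q (Sum.inl (k + 1)) + q (Sum.inr (k + 1))) := by
  have hz : (send q (k + 2) : ℝ) =
      ((q (Sum.inl (k + 1)) + q (Sum.inr (k + 1)) : ℝ≥0) : ℝ) + send q (k + 1) := by
    rw [send_succ q (k + 1)]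
    push_cast
    ring
  have h0 : (send q (k + 1) : ℝ) = 0 + (send q (k + 1) : ℝ) := (zero_add _).symm
  rw [hz]
  nth_rewrite 1 [h0]
  rw [← intervalIntegral.integral_comp_add_right
    (fun t => h (t.toNNReal - sample q k)), reward]
  refine intervalIntegral.integral_congr fun u hu => ?_
  rw [Set.uIcc_of_le (NNReal.coe_nonneg _)] at hu
  rw [Real.toNNReal_add hu.1 (NNReal.coe_nonneg _), Real.toNNReal_coe, send_succ, ← sample]
  congr 1
  rw [add_comm (sample q k), ← add_assoc, add_tsub_cancel_right]

/-- The pathwise core: `ψ` is the conditional freshness and `h` its equilibrium profile. Replacing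
one by the other costs `o` of the cycle length per cycle, hence `o(n)` over `n` cycles. -/
theorem tendsto_average {q : Delays} {ψ h : ℝ≥0 → ℝ} (hψ : Measurable ψ) (hψ0 : ∀ t, 0 ≤ ψ t)
    (hψ1 : ∀ t, ψ t ≤ 1) (hh : Measurable h) (hh0 : ∀ t, 0 ≤ h t)
    (hh1 : ∀ t, h t ≤ 1) {ε : ℝ≥0 → ℝ} (hε : Tendsto ε atTop (𝓝 0))
    (hclose : ∀ k t, send q (k + 1) ≤ t → t < send q (k + 2) →
      |ψ t - h (t - sample q k)| ≤ ε (sample q k))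
    {m ρ : ℝ} (hm : 0 < m) (hs : Tendsto (fun n : ℕ => (send q n : ℝ) / n) atTop (𝓝 m))
    (hr : Tendsto (fun n : ℕ => (∑ k ∈ Finset.range n,
      reward h (q (Sum.inr k)) (q (Sum.inl (k + 1)) + q (Sum.inr (k + 1)))) / n) atTop (𝓝 ρ)) :
    Tendsto (fun T : ℝ => (∫ t in (0 : ℝ)..T, ψ t.toNNReal) / T) atTop (𝓝 (ρ / m)) := by
  have hbdi : ∀ {f : ℝ → ℝ}, Measurable f → (∀ t, 0 ≤ f t) → (∀ t, f t ≤ 1) → ∀ a b,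
      IntervalIntegrable f volume a b := by
    intro f hf h0 h1 a b
    have hc : IntervalIntegrable (fun _ : ℝ => (1 : ℝ)) volume a b := intervalIntegrable_const
    refine hc.mono_fun hf.aestronglyMeasurable (Eventually.of_forall fun t => ?_)
    simpa [abs_of_nonneg (h0 t)] using h1 t
  have hψi : ∀ a b, IntervalIntegrable (fun t : ℝ => ψ t.toNNReal) volume a b :=
    hbdi (hψ.comp measurable_real_toNNReal) (fun _ => hψ0 _) fun _ => hψ1 _
  have hhi : ∀ k a b, IntervalIntegrable (fun t : ℝ => h (t.toNNReal - sample q k)) volume a b :=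
    fun k => hbdi (hh.comp (measurable_real_toNNReal.sub_const _)) (fun _ => hh0 _) fun _ => hh1 _
  have hst : Tendsto (fun n => (send q n : ℝ)) atTop atTop := tendsto_atTop_of_div_natCast hm hs
  refine tendsto_div_of_tendsto_renewal ?_ (by simp) (s := fun n => (send q n : ℝ))
    (by simp [send]) (fun a b hab => NNReal.coe_le_coe.2 (send_mono q hab)) hm hs ?_
  · intro a _ b _ hab
    dsimp only
    rw [← intervalIntegral.integral_add_adjacent_intervals (hψi 0 a) (hψi a b)]
    have := intervalIntegral.integral_nonneg (μ := volume) (f := fun t : ℝ => ψ t.toNNReal) hab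
      fun t _ => hψ0 _
    linarith
  -- Integrate up to receipt time `n + 1`: the first `n` complete cycles begin only at the first
  -- receipt.
  rw [← tendsto_div_natCast_succ_iff (u := fun n => ∫ t in (0 : ℝ)..(send q n : ℝ), ψ t.toNNReal)]
  set z : ℕ → ℝ := fun k => (send q (k + 2) : ℝ) - send q (k + 1) with hz
  have hz0 : ∀ k, 0 ≤ z k := fun k =>
    sub_nonneg.2 (NNReal.coe_le_coe.2 (send_mono q (Nat.le_succ _)))
  set err : ℕ → ℝ := fun k =>
    ∫ t in (send q (k + 1) : ℝ)..(send q (k + 2) : ℝ),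
      (ψ t.toNNReal - h (t.toNNReal - sample q k)) with herr
  have herrle : ∀ k, ‖err k‖ ≤ ε (sample q k) * z k := by
    intro k
    rw [← abs_of_nonneg (hz0 k)]
    refine intervalIntegral.norm_integral_le_of_norm_le_const_ae ?_
    -- The closeness hypothesis excludes the right endpoint while the interval integral includes it;
    -- one point is null.
    have hne : ∀ᵐ t : ℝ, t ≠ (send q (k + 2) : ℝ) := by simp [ae_iff]
    filter_upwards [hne] with t ht hmem
    rw [Set.uIoc_of_le (NNReal.coe_le_coe.2 (send_mono q (Nat.le_succ _)))] at hmem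
    have htpos : 0 ≤ t := (NNReal.coe_nonneg _).trans hmem.1.le
    refine hclose k _ ?_ ?_
    · rw [← NNReal.coe_le_coe, Real.coe_toNNReal t htpos]
      exact hmem.1.le
    · rw [← NNReal.coe_lt_coe, Real.coe_toNNReal t htpos]
      exact lt_of_le_of_ne hmem.2 ht
  have hsample : Tendsto (fun k => sample q k) atTop atTop :=
    tendsto_atTop_mono (fun k => (le_self_add : send q k ≤ sample q k))
      (NNReal.tendsto_coe_atTop.1 hst)
  have hlo : err =o[atTop] z := by
    refine Asymptotics.isLittleO_iff.2 fun c hc => ?_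
    filter_upwards [(hε.comp hsample).eventually (gt_mem_nhds hc)] with k hk
    rw [Real.norm_of_nonneg (hz0 k)]
    exact (herrle k).trans (mul_le_mul_of_nonneg_right (le_of_lt hk) (hz0 k))
  have hsumz : ∀ n, ∑ k ∈ Finset.range n, z k = (send q (n + 1) : ℝ) - send q 1 := fun n => by
    rw [hz]
    exact Finset.sum_range_sub (fun k => (send q (k + 1) : ℝ)) n
  have hzt : Tendsto (fun n : ℕ => (∑ k ∈ Finset.range n, z k) / n) atTop (𝓝 m) := by
    have h1 := ((tendsto_div_natCast_succ_iff (u := fun n => (send q n : ℝ))).2 hs).sub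
      (tendsto_const_div_atTop_nhds_zero_nat (send q 1 : ℝ))
    rw [sub_zero] at h1
    refine h1.congr fun n => ?_
    rw [hsumz, sub_div]
  have hsum := hlo.sum_range hz0 (tendsto_atTop_of_div_natCast hm hzt)
  have herr0 : Tendsto (fun n : ℕ => (∑ k ∈ Finset.range n, err k) / n) atTop (𝓝 0) := by
    have h1 := (hsum.tendsto_div_nhds_zero).mul hzt
    rw [zero_mul] at h1
    refine h1.congr' ?_
    filter_upwards [(tendsto_atTop_of_div_natCast hm hzt).eventually_gt_atTop 0] with n hn
    field_simp
  -- The period before the first reply contributes a constant, which disappears after division by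
  -- `n`.
  have hlim := ((tendsto_const_div_atTop_nhds_zero_nat
    (∫ t in (0 : ℝ)..(send q 1 : ℝ), ψ t.toNNReal)).add hr).add herr0
  rw [zero_add, add_zero] at hlim
  refine hlim.congr fun n => ?_
  rw [← add_div, ← add_div]
  congr 1
  have hadj : ∑ k ∈ Finset.range n,
      ∫ t in (send q (k + 1) : ℝ)..(send q (k + 2) : ℝ), ψ t.toNNReal =
      ∫ t in (send q 1 : ℝ)..(send q (n + 1) : ℝ), ψ t.toNNReal :=
    intervalIntegral.sum_integral_adjacent_intervals
      (a := fun k => (send q (k + 1) : ℝ)) fun k _ => hψi _ _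
  rw [← intervalIntegral.integral_add_adjacent_intervals (hψi 0 (send q 1))
      (hψi _ (send q (n + 1))),
    ← hadj, add_assoc, ← Finset.sum_add_distrib]
  congr 1
  refine Finset.sum_congr rfl fun k _ => ?_
  rw [← integral_age_eq_reward, herr]
  dsimp only
  rw [intervalIntegral.integral_sub (hψi _ _) (hhi k _ _)]
  ring

end Delays

/-! ### Cesàro averages, the layer-cake formula and the cycle reward. -/

/-- Cesàro averages converge if they do along the even and along the odd indices. -/
theorem tendsto_average_of_even_odd {u : ℕ → ℝ} {a : ℝ}
    (he : Tendsto (fun n : ℕ => (∑ j ∈ Finset.range n, u (2 * j)) / n) atTop (𝓝 a))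
    (ho : Tendsto (fun n : ℕ => (∑ j ∈ Finset.range n, u (2 * j + 1)) / n) atTop (𝓝 a)) :
    Tendsto (fun n : ℕ => (∑ j ∈ Finset.range n, u j) / n) atTop (𝓝 a) := by
  have hsplit : ∀ n, ∑ j ∈ Finset.range n, u j =
      ∑ j ∈ Finset.range ((n + 1) / 2), u (2 * j) + ∑ j ∈ Finset.range (n / 2), u (2 * j + 1) := by
    intro n
    induction n with
    | zero => simp
    | succ n ih =>
      rw [Finset.sum_range_succ, ih]
      obtain ⟨m, rfl | rfl⟩ := Nat.even_or_odd' n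
      · rw [show (2 * m + 1) / 2 = m by omega, show (2 * m + 1 + 1) / 2 = m + 1 by omega,
          show 2 * m / 2 = m by omega, Finset.sum_range_succ]
        ring
      · rw [show (2 * m + 1 + 1) / 2 = m + 1 by omega, show (2 * m + 1) / 2 = m by omega,
          show (2 * m + 1 + 1 + 1) / 2 = m + 1 by omega,
          Finset.sum_range_succ (fun j => u (2 * j + 1))]
        ring
  have hhalf : Tendsto (fun n : ℕ => ((n / 2 : ℕ) : ℝ) / n) atTop (𝓝 (1 / 2)) := by
    have hl : Tendsto (fun n : ℕ => 1 / 2 - 1 / (n : ℝ)) atTop (𝓝 (1 / 2)) := by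
      simpa using (tendsto_one_div_atTop_nhds_zero_nat (𝕜 := ℝ)).const_sub (1 / 2 : ℝ)
    refine tendsto_of_tendsto_of_tendsto_of_le_of_le' hl tendsto_const_nhds ?_ ?_
    · filter_upwards [eventually_gt_atTop 0] with n hn
      have h0 : (0 : ℝ) < n := Nat.cast_pos.2 hn
      have h1 : (n : ℝ) ≤ 2 * (n / 2 : ℕ) + 1 := by exact_mod_cast (by omega : n ≤ 2 * (n / 2) + 1)
      rw [le_div_iff₀ h0, sub_mul, one_div_mul_cancel h0.ne']
      linarith
    · filter_upwards [eventually_gt_atTop 0] with n hn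
      have h0 : (0 : ℝ) < n := Nat.cast_pos.2 hn
      have h1 : 2 * ((n / 2 : ℕ) : ℝ) ≤ n := by exact_mod_cast (by omega : 2 * (n / 2) ≤ n)
      rw [div_le_iff₀ h0]
      linarith
  have hhalf' : Tendsto (fun n : ℕ => (((n + 1) / 2 : ℕ) : ℝ) / n) atTop (𝓝 (1 / 2)) :=
    (tendsto_div_natCast_succ_iff (u := fun n => ((n / 2 : ℕ) : ℝ))).2 hhalf
  have ht : Tendsto (fun n : ℕ => n / 2) atTop atTop := Nat.tendsto_div_const_atTop two_ne_zero
  have hlim := ((he.comp (ht.comp (tendsto_add_atTop_nat 1))).mul hhalf').add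
    ((ho.comp ht).mul hhalf)
  rw [show a * (1 / 2) + a * (1 / 2) = a by ring] at hlim
  refine hlim.congr' ?_
  filter_upwards [eventually_ge_atTop 2] with n hn
  have h1 : ((n / 2 : ℕ) : ℝ) ≠ 0 := Nat.cast_ne_zero.2 (by omega)
  have h2 : (((n + 1) / 2 : ℕ) : ℝ) ≠ 0 := Nat.cast_ne_zero.2 (by omega)
  simp only [Function.comp_apply]
  rw [div_mul_div_cancel₀ h2, div_mul_div_cancel₀ h1, ← add_div, ← hsplit]

/-- The layer-cake formula with a bounded density. -/
theorem integral_intervalIntegral_eq_tail (ν : Measure ℝ) [IsProbabilityMeasure ν]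
    (hν0 : ∀ᵐ z ∂ν, 0 ≤ z) (hν : Integrable (fun z => z) ν) {g : ℝ → ℝ} (hg : Measurable g)
    (hg0 : ∀ u, 0 ≤ g u) (hg1 : ∀ u, g u ≤ 1) :
    ∫ z, (∫ u in (0 : ℝ)..z, g u) ∂ν = ∫ u in Set.Ioi (0 : ℝ), g u * (1 - cdf ν u) := by
  -- The inner integral is written with the strict indicator of `u < z`, so that after Fubini the
  -- mass is that of `Ioi u`, exactly `1 - cdf ν u`, even if `ν` has atoms.
  have hm : Measurable (Function.uncurry fun z u : ℝ => (Set.Iio z).indicator g u) := by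
    have : (Function.uncurry fun z u : ℝ => (Set.Iio z).indicator g u) =
        Set.indicator {r : ℝ × ℝ | r.2 < r.1} fun r => g r.2 := by
      ext r
      simp [Function.uncurry, Set.indicator_apply]
    rw [this]
    exact (hg.comp measurable_snd).indicator (measurableSet_lt measurable_snd measurable_fst)
  have hset : ∀ z : ℝ, ∫ u in Set.Ioi (0 : ℝ), (Set.Iio z).indicator g u =
      ∫ u in Set.Ioo 0 z, g u := fun z => by
    rw [setIntegral_indicator measurableSet_Iio, Set.Ioi_inter_Iio]
  have hgi : ∀ z : ℝ, IntegrableOn g (Set.Ioo 0 z) := fun z =>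
    Measure.integrableOn_of_bounded (M := 1) (by simp) hg.aestronglyMeasurable
      (Eventually.of_forall fun u => by rw [Real.norm_of_nonneg (hg0 u)]; exact hg1 u)
  have hint : Integrable (Function.uncurry fun z u : ℝ => (Set.Iio z).indicator g u)
      (ν.prod (volume.restrict (Set.Ioi 0))) := by
    refine (integrable_prod_iff hm.aestronglyMeasurable).2 ⟨Eventually.of_forall fun z => ?_, ?_⟩
    · have : Integrable ((Set.Iio z).indicator g) (volume.restrict (Set.Ioi 0)) := by
        rw [integrable_indicator_iff measurableSet_Iio, IntegrableOn,
          Measure.restrict_restrict measurableSet_Iio, Set.Iio_inter_Ioi]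
        exact hgi z
      exact this
    · refine hν.abs.mono' hm.aestronglyMeasurable.norm.integral_prod_right'
        (Eventually.of_forall fun z => ?_)
      have h1 : ∀ u, ‖(Set.Iio z).indicator g u‖ = (Set.Iio z).indicator g u := fun u =>
        Real.norm_of_nonneg (Set.indicator_nonneg (fun u _ => hg0 u) u)
      simp only [Function.uncurry, h1]
      rw [hset]
      refine (norm_setIntegral_le_of_norm_le_const (C := 1) (by simp) fun u _ => ?_).trans ?_
      · rw [Real.norm_of_nonneg (hg0 u)]
        exact hg1 u
      · rw [one_mul, Real.volume_real_Ioo, sub_zero]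
        exact max_le (le_abs_self z) (abs_nonneg z)
  calc _ = ∫ z, (∫ u in Set.Ioi (0 : ℝ), (Set.Iio z).indicator g u) ∂ν := by
        refine integral_congr_ae ?_
        filter_upwards [hν0] with z hz
        rw [hset, intervalIntegral.integral_of_le hz, integral_Ioc_eq_integral_Ioo]
    _ = ∫ u in Set.Ioi (0 : ℝ), (∫ z, (Set.Iio z).indicator g u ∂ν) := integral_integral_swap hint
    _ = _ := by
        refine integral_congr_ae (Eventually.of_forall fun u => ?_)
        have h1 : (fun z => (Set.Iio z).indicator g u) =
            (Set.Ioi u).indicator fun _ => g u := by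
          ext z
          simp [Set.indicator_apply]
        dsimp only
        rw [h1, integral_indicator_const _ measurableSet_Ioi, cdf_eq_real, ← Set.compl_Iic,
          probReal_compl_eq_one_sub measurableSet_Iic, smul_eq_mul, mul_comm]

namespace Delays

theorem measurable_reward {h : ℝ≥0 → ℝ} (hh : Measurable h) :
    Measurable fun r : ℝ≥0 × ℝ≥0 => reward h r.1 r.2 := by
  have h1 : (fun r : ℝ≥0 × ℝ≥0 => reward h r.1 r.2) = fun r => ∫ u : ℝ,
      Set.indicator {s : (ℝ≥0 × ℝ≥0) × ℝ | 0 < s.2 ∧ s.2 ≤ s.1.2}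
        (fun s => h (s.2.toNNReal + s.1.1)) (r, u) := by
    ext r
    rw [reward, intervalIntegral.integral_of_le (NNReal.coe_nonneg r.2), ← integral_indicator measurableSet_Ioc]
    rfl
  rw [h1]
  refine (StronglyMeasurable.integral_prod_right' (Measurable.stronglyMeasurable ?_)).measurable
  refine Measurable.indicator ?_ ?_
  · exact hh.comp ((measurable_real_toNNReal.comp measurable_snd).add
      (measurable_fst.comp measurable_fst))
  · exact (measurableSet_lt measurable_const measurable_snd).inter (measurableSet_le measurable_snd
      (measurable_coe_nnreal_real.comp (measurable_snd.comp measurable_fst)))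

theorem norm_reward_le {h : ℝ≥0 → ℝ} (hh0 : ∀ a, 0 ≤ h a) (hh1 : ∀ a, h a ≤ 1) (d z : ℝ≥0) :
    ‖reward h d z‖ ≤ z := by
  have := intervalIntegral.norm_integral_le_of_norm_le_const (a := 0) (b := (z : ℝ)) (C := 1)
    (f := fun u : ℝ => h (u.toNNReal + d)) fun u _ => by
      rw [Real.norm_of_nonneg (hh0 _)]; exact hh1 _
  simpa [reward] using this

theorem reward_sum {N : ℕ} (p : Fin N → ℝ) {h : Fin N → ℝ≥0 → ℝ} (hh : ∀ i, Measurable (h i))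
    (hh0 : ∀ i a, 0 ≤ h i a) (hh1 : ∀ i a, h i a ≤ 1) (d z : ℝ≥0) :
    reward (fun a => ∑ i, p i * h i a) d z = ∑ i, p i * reward (h i) d z := by
  simp only [reward]
  rw [intervalIntegral.integral_finsetSum]
  · simp only [intervalIntegral.integral_const_mul]
  · intro i _
    refine IntervalIntegrable.const_mul ?_ _
    have hc : IntervalIntegrable (fun _ : ℝ => (1 : ℝ)) volume 0 z := intervalIntegrable_const
    refine hc.mono_fun ((hh i).comp
      (measurable_real_toNNReal.add_const d)).aestronglyMeasurable (Eventually.of_forall fun t => ?_)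
    simpa [abs_of_nonneg (hh0 i _)] using hh1 i _

end Delays

/-! ### The law of the total delay and the mean cycle reward. -/

section Laws

variable {νY νD : Measure ℝ≥0}

theorem measurable_totalDelay : Measurable fun q : ℝ≥0 × ℝ≥0 => (q.1 : ℝ) + (q.2 : ℝ) :=
  (measurable_coe_nnreal_real.comp measurable_fst).add
    (measurable_coe_nnreal_real.comp measurable_snd)

theorem ae_totalDelayLaw_nonneg : ∀ᵐ z ∂(totalDelayLaw νY νD), 0 ≤ z := by
  rw [totalDelayLaw, ae_map_iff measurable_totalDelay.aemeasurable measurableSet_Ici]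
  exact Eventually.of_forall fun q => by positivity

variable [IsProbabilityMeasure νY] [IsProbabilityMeasure νD]

instance : IsProbabilityMeasure (totalDelayLaw νY νD) :=
  Measure.isProbabilityMeasure_map measurable_totalDelay.aemeasurable

theorem integrable_totalDelay (hY : Integrable (fun y : ℝ≥0 => (y : ℝ)) νY)
    (hD : Integrable (fun d : ℝ≥0 => (d : ℝ)) νD) :
    Integrable (fun q : ℝ≥0 × ℝ≥0 => (q.1 : ℝ) + (q.2 : ℝ)) (νY.prod νD) :=
  (hY.comp_fst νD).add (hD.comp_snd νY)

theorem integrable_totalDelayLaw (hY : Integrable (fun y : ℝ≥0 => (y : ℝ)) νY)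
    (hD : Integrable (fun d : ℝ≥0 => (d : ℝ)) νD) :
    Integrable (fun z => z) (totalDelayLaw νY νD) := by
  rw [totalDelayLaw, integrable_map_measure measurable_id'.aestronglyMeasurable
    measurable_totalDelay.aemeasurable]
  exact integrable_totalDelay hY hD

theorem measurable_cycleReward {h : ℝ≥0 → ℝ} (hh : Measurable h) :
    Measurable fun v : ℝ≥0 × (ℝ≥0 × ℝ≥0) => Delays.reward h v.1 (v.2.1 + v.2.2) :=
  (Delays.measurable_reward hh).comp (measurable_fst.prodMk
    ((measurable_fst.comp measurable_snd).add (measurable_snd.comp measurable_snd)))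

theorem integrable_cycleReward (hY : Integrable (fun y : ℝ≥0 => (y : ℝ)) νY)
    (hD : Integrable (fun d : ℝ≥0 => (d : ℝ)) νD) {h : ℝ≥0 → ℝ} (hh : Measurable h)
    (hh0 : ∀ a, 0 ≤ h a) (hh1 : ∀ a, h a ≤ 1) :
    Integrable (fun v : ℝ≥0 × (ℝ≥0 × ℝ≥0) => Delays.reward h v.1 (v.2.1 + v.2.2))
      (νD.prod (νY.prod νD)) := by
  refine ((integrable_totalDelay hY hD).comp_snd νD).mono'
    (measurable_cycleReward hh).aestronglyMeasurable (Eventually.of_forall fun v => ?_)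
  simpa using Delays.norm_reward_le hh0 hh1 v.1 (v.2.1 + v.2.2)

/-- The starting age is independent of the cycle length under the product law: fix the age and apply
the layer-cake formula to the length. -/
theorem integral_cycleReward (hY : Integrable (fun y : ℝ≥0 => (y : ℝ)) νY)
    (hD : Integrable (fun d : ℝ≥0 => (d : ℝ)) νD) {h : ℝ≥0 → ℝ} (hh : Measurable h)
    (hh0 : ∀ a, 0 ≤ h a) (hh1 : ∀ a, h a ≤ 1) :
    ∫ v, Delays.reward h v.1 (v.2.1 + v.2.2) ∂(νD.prod (νY.prod νD)) =
      ∫ d, (∫ t in Set.Ioi (0 : ℝ), h (t.toNNReal + d) * (1 - cdf (totalDelayLaw νY νD) t)) ∂νD := by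
  rw [integral_prod _ (integrable_cycleReward hY hD hh hh0 hh1)]
  refine integral_congr_ae (Eventually.of_forall fun d => ?_)
  dsimp only
  rw [← integral_intervalIntegral_eq_tail _ ae_totalDelayLaw_nonneg
    (integrable_totalDelayLaw hY hD) (g := fun t => h (t.toNNReal + d))
    (hh.comp (measurable_real_toNNReal.add_const d))
    (fun _ => hh0 _) (fun _ => hh1 _), totalDelayLaw,
    integral_map measurable_totalDelay.aemeasurable]
  · refine integral_congr_ae (Eventually.of_forall fun v => ?_)
    simp [Delays.reward]
  · refine StronglyMeasurable.aestronglyMeasurable ?_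
    have hm : Measurable fun u : ℝ => h (u.toNNReal + d) :=
      hh.comp (measurable_real_toNNReal.add_const d)
    refine Continuous.stronglyMeasurable ?_
    refine intervalIntegral.continuous_primitive (fun a b => ?_) 0
    have hc : IntervalIntegrable (fun _ : ℝ => (1 : ℝ)) volume a b := intervalIntegrable_const
    refine hc.mono_fun hm.aestronglyMeasurable (Eventually.of_forall fun t => ?_)
    simpa [abs_of_nonneg (hh0 _)] using hh1 _

theorem meanFreshTime_zeroWait {N : ℕ} {Q : Matrix (Fin N) (Fin N) ℝ}
    (hQ : IsIrreducibleGenerator Q) (hY : Integrable (fun y : ℝ≥0 => (y : ℝ)) νY)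
    (hD : Integrable (fun d : ℝ≥0 => (d : ℝ)) νD) {e : Fin N → ℝ≥0 → Fin N}
    (he : ∀ i, Measurable (e i)) (i : Fin N) :
    meanFreshTime Q e νY νD (zeroWait N) i =
      ∫ v, Delays.reward (freshKernel Q e i) v.1 (v.2.1 + v.2.2) ∂(νD.prod (νY.prod νD)) := by
  rw [integral_cycleReward hY hD (measurable_freshKernel he i) (freshKernel_nonneg hQ i)
    (freshKernel_le_one hQ i), meanFreshTime]
  refine integral_congr_ae (Eventually.of_forall fun d => ?_)
  refine setIntegral_congr_fun measurableSet_Ioi fun t ht => ?_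
  simp [zeroWait, freshKernel, Real.coe_toNNReal t (le_of_lt ht)]

end Laws

/-! ### Strong laws for cycle rewards and receipt times. -/

section StrongLaw

variable {Ω : Type*} [MeasurableSpace Ω] {μ : Measure Ω} {N : ℕ}
  {X : ℝ≥0 → Ω → Fin N} {νY νD : Measure ℝ≥0} {Y D : ℕ → Ω → ℝ≥0}

/-- The delays that determine the reward between two receptions. -/
def cycle (Y D : ℕ → Ω → ℝ≥0) (k : ℕ) (ω : Ω) : ℝ≥0 × (ℝ≥0 × ℝ≥0) :=
  (D k ω, (Y (k + 1) ω, D (k + 1) ω))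

theorem IsDelaySystem.measurable_cycle (hYD : IsDelaySystem μ X νY νD Y D) (k : ℕ) :
    Measurable (cycle Y D k) :=
  (hYD.measurable_backward k).prodMk
    ((hYD.measurable_forward (k + 1)).prodMk (hYD.measurable_backward (k + 1)))

/-- Adjacent cycles share a backward delay, which ends one and is the initial age of the next; all
other pairs use disjoint sets of delays. -/
theorem IsDelaySystem.indep_cycle (hYD : IsDelaySystem μ X νY νD Y D) {k l : ℕ} (h1 : k ≠ l)
    (h2 : k ≠ l + 1) (h3 : k + 1 ≠ l) : IndepFun (cycle Y D k) (cycle Y D l) μ := by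
  let S : ℕ → Finset (ℕ ⊕ ℕ) := fun k => {Sum.inr k, Sum.inl (k + 1), Sum.inr (k + 1)}
  have hdisj : Disjoint (S k) (S l) := by
    simp only [S, Finset.disjoint_left, Finset.mem_insert, Finset.mem_singleton]
    rintro a (rfl | rfl | rfl) <;> simp <;> omega
  have h := hYD.indep_delays.indepFun_finset (S k) (S l) hdisj hYD.measurable_sum
  have hmem : ∀ k, Sum.inr k ∈ S k ∧ Sum.inl (k + 1) ∈ S k ∧ Sum.inr (k + 1) ∈ S k :=
    fun k => by simp [S]
  let φ : ∀ k, (S k → ℝ≥0) → ℝ≥0 × (ℝ≥0 × ℝ≥0) := fun k x =>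
    (x ⟨_, (hmem k).1⟩, (x ⟨_, (hmem k).2.1⟩, x ⟨_, (hmem k).2.2⟩))
  have hφ : ∀ k, Measurable (φ k) := fun k =>
    (measurable_pi_apply _).prodMk ((measurable_pi_apply _).prodMk (measurable_pi_apply _))
  exact h.comp (hφ k) (hφ l)

variable [IsProbabilityMeasure μ]

theorem IsDelaySystem.map_pair (hYD : IsDelaySystem μ X νY νD Y D) (k : ℕ) :
    μ.map (fun ω => (Y k ω, D k ω)) = νY.prod νD := by
  have h : IndepFun (Y k) (D k) μ :=
    hYD.indep_delays.indepFun (i := Sum.inl k) (j := Sum.inr k) (by simp)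
  rw [(indepFun_iff_map_prod_eq_prod_map_map (hYD.measurable_forward k).aemeasurable
    (hYD.measurable_backward k).aemeasurable).1 h, hYD.law_forward, hYD.law_backward]

theorem IsDelaySystem.map_cycle (hYD : IsDelaySystem μ X νY νD Y D) (k : ℕ) :
    μ.map (cycle Y D k) = νD.prod (νY.prod νD) := by
  have h : IndepFun (D k) (fun ω => (Y (k + 1) ω, D (k + 1) ω)) μ :=
    (hYD.indep_delays.indepFun_prodMk hYD.measurable_sum (Sum.inl (k + 1)) (Sum.inr (k + 1))
      (Sum.inr k) (by simp) (by simp)).symm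
  rw [← hYD.map_pair (k + 1), ← hYD.law_backward k]
  exact (indepFun_iff_map_prod_eq_prod_map_map (hYD.measurable_backward k).aemeasurable
    ((hYD.measurable_forward _).prodMk (hYD.measurable_backward _)).aemeasurable).1 h

/-- The sequence is 1-dependent, so its even and odd subsequences are each pairwise independent and
identically distributed, which is all the strong law requires. Their averages have the same limit
and can be merged. -/
theorem IsDelaySystem.strong_law_cycle (hYD : IsDelaySystem μ X νY νD Y D)
    {f : ℝ≥0 × (ℝ≥0 × ℝ≥0) → ℝ} (hf : Measurable f)
    (hfi : Integrable f (νD.prod (νY.prod νD))) :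
    ∀ᵐ ω ∂μ, Tendsto (fun n : ℕ => (∑ k ∈ Finset.range n, f (cycle Y D k ω)) / n) atTop
      (𝓝 (∫ v, f v ∂(νD.prod (νY.prod νD)))) := by
  have hsub : ∀ r : ℕ, ∀ᵐ ω ∂μ, Tendsto
      (fun n : ℕ => (∑ j ∈ Finset.range n, f (cycle Y D (2 * j + r) ω)) / n) atTop
      (𝓝 (∫ v, f v ∂(νD.prod (νY.prod νD)))) := by
    intro r
    have hint : ∀ k, Integrable (fun ω => f (cycle Y D k ω)) μ := fun k => by
      rw [← hYD.map_cycle k] at hfi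
      exact hfi.comp_measurable (hYD.measurable_cycle k)
    have hid : ∀ k, ∫ ω, f (cycle Y D k ω) ∂μ = ∫ v, f v ∂(νD.prod (νY.prod νD)) := fun k => by
      rw [← hYD.map_cycle k, integral_map (hYD.measurable_cycle k).aemeasurable
        hf.aestronglyMeasurable]
    have h := strong_law_ae (fun j ω => f (cycle Y D (2 * j + r) ω)) (hint _)
      (fun i j hij => (hYD.indep_cycle (by omega) (by omega) (by omega)).comp hf hf)
      fun i => IdentDistrib.comp ⟨(hYD.measurable_cycle _).aemeasurable,
        (hYD.measurable_cycle _).aemeasurable, by rw [hYD.map_cycle, hYD.map_cycle]⟩ hf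
    filter_upwards [h] with ω hω
    rw [hid] at hω
    refine hω.congr fun n => ?_
    rw [smul_eq_mul, div_eq_inv_mul]
  filter_upwards [hsub 0, hsub 1] with ω h0 h1
  exact tendsto_average_of_even_odd (u := fun k => f (cycle Y D k ω)) h0 h1

theorem IsDelaySystem.strong_law_send [IsProbabilityMeasure νY] [IsProbabilityMeasure νD]
    (hYD : IsDelaySystem μ X νY νD Y D) (hY : Integrable (fun y : ℝ≥0 => (y : ℝ)) νY)
    (hD : Integrable (fun d : ℝ≥0 => (d : ℝ)) νD) :
    ∀ᵐ ω ∂μ, Tendsto (fun n : ℕ => (Delays.send (fun s => Sum.elim Y D s ω) n : ℝ) / n) atTop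
      (𝓝 (meanTotalDelay νY νD)) := by
  have hm : ∀ k, Measurable fun ω => (Y k ω, D k ω) := fun k =>
    (hYD.measurable_forward k).prodMk (hYD.measurable_backward k)
  have hint := integrable_totalDelay hY hD
  have hmean : ∫ ω, ((Y 0 ω : ℝ) + D 0 ω) ∂μ = meanTotalDelay νY νD := by
    rw [meanTotalDelay, totalDelayLaw, integral_map measurable_totalDelay.aemeasurable
      measurable_id'.aestronglyMeasurable, ← hYD.map_pair 0, integral_map (hm 0).aemeasurable
      measurable_totalDelay.aestronglyMeasurable]
  have h := strong_law_ae (μ := μ) (fun k ω => (Y k ω : ℝ) + D k ω)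
    (by
      rw [← hYD.map_pair 0] at hint
      exact hint.comp_measurable (hm 0))
    (fun i j hij => (hYD.indep_delays.indepFun_prodMk_prodMk hYD.measurable_sum (Sum.inl i)
      (Sum.inr i) (Sum.inl j) (Sum.inr j) (by simpa using hij) (by simp) (by simp)
      (by simpa using hij)).comp measurable_totalDelay measurable_totalDelay)
    fun i => IdentDistrib.comp (u := fun q : ℝ≥0 × ℝ≥0 => (q.1 : ℝ) + (q.2 : ℝ))
      ⟨(hm i).aemeasurable, (hm 0).aemeasurable,
      by rw [hYD.map_pair, hYD.map_pair]⟩ measurable_totalDelay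
  filter_upwards [h] with ω hω
  rw [hmean] at hω
  refine hω.congr fun n => ?_
  rw [smul_eq_mul, div_eq_inv_mul, Delays.send]
  simp

end StrongLaw

end QueryMBF

end

/-! ### The mean binary freshness formula. -/

theorem corollary2 {Ω : Type*} [MeasurableSpace Ω] (μ : Measure Ω) [IsProbabilityMeasure μ]
    {N : ℕ} (Q : Matrix (Fin N) (Fin N) ℝ) (hQ : IsIrreducibleGenerator Q)
    (X : ℝ≥0 → Ω → Fin N) (hX : IsCTMC μ Q X)
    (p : Fin N → ℝ) (hp : IsStationaryDist Q p)
    (νY νD : Measure ℝ≥0) [IsProbabilityMeasure νY] [IsProbabilityMeasure νD]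
    (hYint : Integrable (fun y : ℝ≥0 => (y : ℝ)) νY)
    (hDint : Integrable (fun d : ℝ≥0 => (d : ℝ)) νD)
    (hZpos : 0 < meanTotalDelay νY νD)
    (Y D : ℕ → Ω → ℝ≥0) (hYD : IsDelaySystem μ X νY νD Y D)
    (e : Fin N → ℝ≥0 → Fin N) (he : ∀ i, Measurable (e i)) (x₀ : Fin N) :
    meanBinaryFreshness μ X (estimate e x₀ (zeroWait N) X Y D) =
      (∑ i, p i * meanFreshTime Q e νY νD (zeroWait N) i) / meanTotalDelay νY νD := by
  set h : ℝ≥0 → ℝ := fun a => ∑ i, p i * freshKernel Q e i a with hh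
  have hhm : Measurable h :=
    Finset.measurable_fun_sum _ fun i _ => (measurable_freshKernel he i).const_mul _
  have hh0 : ∀ a, 0 ≤ h a := fun a =>
    Finset.sum_nonneg fun i _ => mul_nonneg (hp.nonneg i) (freshKernel_nonneg hQ i a)
  have hh1 : ∀ a, h a ≤ 1 := fun a => by
    rw [← hp.sum_eq_one]
    exact Finset.sum_le_sum fun i _ =>
      mul_le_of_le_one_right (hp.nonneg i) (freshKernel_le_one hQ i a)
  have hρ : ∫ v, Delays.reward h v.1 (v.2.1 + v.2.2) ∂(νD.prod (νY.prod νD)) =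
      ∑ i, p i * meanFreshTime Q e νY νD (zeroWait N) i := by
    simp only [hh, Delays.reward_sum p (measurable_freshKernel he) (freshKernel_nonneg hQ)
      (freshKernel_le_one hQ)]
    rw [integral_finsetSum]
    · simp only [integral_const_mul, meanFreshTime_zeroWait hQ hYint hDint he]
    · exact fun i _ => (integrable_cycleReward hYint hDint (measurable_freshKernel he i)
        (freshKernel_nonneg hQ i) (freshKernel_le_one hQ i)).const_mul _
  set q : Ω → Delays := fun ω s => Sum.elim Y D s ω with hq
  have hψm := hX.measurable_freshProb (x₀ := x₀) he
  have hlim : ∀ᵐ ω ∂μ, Tendsto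
      (fun T : ℝ => (∫ t in (0 : ℝ)..T, hX.freshProb e x₀ (q ω) t.toNNReal) / T) atTop
      (𝓝 ((∑ i, p i * meanFreshTime Q e νY νD (zeroWait N) i) / meanTotalDelay νY νD)) := by
    filter_upwards [hYD.strong_law_send hYint hDint,
      hYD.strong_law_cycle (measurable_cycleReward hhm)
        (integrable_cycleReward hYint hDint hhm hh0 hh1)] with ω h1 h2
    rw [hρ] at h2
    exact Delays.tendsto_average (hψm.comp (measurable_const.prodMk measurable_id))
      (hX.freshProb_nonneg _) (hX.freshProb_le_one _) hhm hh0 hh1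
      (hX.tendsto_distToStationary hQ hp) (fun k t => hX.abs_freshProb_sub_le hQ p) hZpos h1 h2
  -- The upper limit is a genuine limit: time averages of the conditional freshness are bounded by
  -- 1, so their almost sure convergence passes to expectations.
  refine Tendsto.limsup_eq ?_
  have hdct := tendsto_integral_filter_of_dominated_convergence (μ := μ) (l := atTop)
    (F := fun (T : ℝ) ω => (∫ t in (0 : ℝ)..T, hX.freshProb e x₀ (q ω) t.toNNReal) / T)
    (fun _ => (1 : ℝ)) ?_ ?_ (integrable_const _) hlim
  · simp only [integral_const, probReal_univ, one_smul] at hdct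
    refine hdct.congr' ?_
    filter_upwards [eventually_ge_atTop 0] with T hT
    rw [hYD.integral_fresh hX he hT, integral_div, one_div, div_eq_inv_mul]
  · filter_upwards [eventually_ge_atTop 0] with T hT
    simp only [intervalIntegral.integral_of_le hT]
    refine StronglyMeasurable.aestronglyMeasurable (StronglyMeasurable.div ?_
      stronglyMeasurable_const)
    refine StronglyMeasurable.integral_prod_right
      (f := fun (ω : Ω) (t : ℝ) => hX.freshProb e x₀ (q ω) t.toNNReal) ?_
    exact (hψm.comp ((hYD.measurable_delays.comp measurable_fst).prodMk
      (measurable_real_toNNReal.comp measurable_snd))).stronglyMeasurable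
  · filter_upwards [eventually_gt_atTop 0] with T hT
    refine Eventually.of_forall fun ω => ?_
    rw [norm_div, Real.norm_of_nonneg hT.le, div_le_one hT]
    have := intervalIntegral.norm_integral_le_of_norm_le_const (a := 0) (b := T) (C := 1)
      (f := fun t : ℝ => hX.freshProb e x₀ (q ω) t.toNNReal) fun t _ => by
        rw [Real.norm_of_nonneg (hX.freshProb_nonneg _ _)]
        exact hX.freshProb_le_one _ _
    simpa [abs_of_pos hT] using this
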